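/- Let $G^L$ be the simple ladder graph, with vertex set $\{0,1\}\times\mathbb Z$, rungs $z_m=\{(0,m),(1,m)\}$ and horizontal edges $h_{i,m}=\{(i,m-1),(i,m)\}$ ($m\in\mathbb Z$, $i\in\{0,1\}$). For $c\in(0,\infty)$ give every rung weight $c$ and every horizontal edge weight $1$. Let $\mathbf P^c_n$ be the probability measure on the spanning trees of the subgraph induced by $\{0,1\}\times\{-n,\dots,n\}$ that is proportional to the product of the edge weights of the tree, and let $\mathbf P^c=\lim_{n\to\infty}\mathbf P^c_n$ (convergence on events depending on finitely many edges). Let $T$ be the random edge set with law $\mathbf P^c$ and $X_m=\mathbf 1\{z_m\in T\}$, $m\in\mathbb Z$; for $c=\infty$ put $X\equiv1$. For $p\in[0,1]$ let $(Y_m)_{m\in\mathbb Z}$ be i.i.d. Bernoulli($p$) and independent of $X$, and let $\tilde X_m=X_mY_m$. A $\{0,1\}^{\mathbb Z}$-valued process $X$ is a Hermitian determinantal process with matrix $A=(A_{k,l})_{k,l\in\mathbb Z}$ if $A$ is Hermitian and $\mathbf P[X_s=1\text{ for all }s\in S]=\det\big((A_{i,j})_{i,j\in S}\big)$ for every finite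 $S\subset\mathbb Z$. If $A$ is moreover a Toeplitz matrix, its Fourier transform is the measurable function $f:[0,1]\to[0,1]$ with $A_{k,l}=\hat f(l-k)$, where $\hat f(k)=\int_0^1 f(x)e^{-2\pi ikx}\,dx$. A stationary process $X$ is a renewal process if, given $X_0=1$, the families $(X_m)_{m>0}$ and $(X_m)_{m<0}$ are independent (no condition if $\mathbf P[X_0=1]=0$). Theorem. For $\alpha\in[0,1)$ let $c=\frac{(1-\alpha)^2}{2\alpha}>0$ if $\alpha>0$, and $c=\infty$ if $\alpha=0$. For $\alpha\in(0,1)$ the limit $\mathbf P^c$ exists as a probability measure and is unique. Furthermore, for every $\alpha\in[0,1)$ and $p\in[0,1]$: (i) $X$ is a stationary Hermitian determinantal process with matrix $A_{k,l}=\hat f(l-k)$, where $$\hat f(k)=\frac{1-\alpha}{1+\alpha}\,\alpha^{|k|}\quad(k\in\mathbb Z),\qquad f(x)=\frac{c}{c+1-\cos(2\pi x)}$$ (with $0^0=1$, and $f\equiv1$ if $c=\infty$). Moreover, $X$ is a renewal process with $$\mathbf P\big[\inf\{k\ge1:X_k=1\}=m\,\big|\,X_0=1\big]=(1-\alpha)^2\,m\,\alpha^{m-1},\qquad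 m=1,2,\dots$$ (ii) $\tilde X$ is a stationary Hermitian determinantal process with matrix $pA$ and Fourier transform $\tilde f(x)=\frac{pc}{c+1-\cos(2\pi x)}$ (read as $p$ if $c=\infty$). (iii) Every stationary $\{0,1\}^{\mathbb Z}$-valued process that is a Hermitian determinantal process (for some Hermitian matrix) and a renewal process has the distribution of $\tilde X$ for some $\alpha\in[0,1)$ and $p\in[0,1]$. -/

import Mathlib

open MeasureTheory ProbabilityTheory Set Filter Topology
open scoped ENNReal

noncomputable section

/-! ## Weighted spanning trees of finite subgraphs -/

open Classical in
/-- The spanning trees, as sets of edges, of the subgraph of `G` induced by the finite vertex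
set `W`. -/
def spanningTrees {V : Type*} (G : SimpleGraph V) (W : Finset V) : Finset (Finset (Sym2 V)) :=
  W.sym2.powerset.filter fun t =>
    (t : Set (Sym2 V)) ⊆ G.edgeSet ∧
      ((SimpleGraph.fromEdgeSet (t : Set (Sym2 V))).induce (W : Set V)).IsTree

/-- The weight of a set of edges. -/
def treeWeight {V : Type*} (w : Sym2 V → ℝ) (t : Finset (Sym2 V)) : ℝ := ∏ e ∈ t, w e

open Classical in
/-- The probability of the event `B` under the weighted spanning tree measure, with weight
function `w`, of the subgraph of `G` induced by `W`. -/
def treeProb {V : Type*} (G : SimpleGraph V) (W : Finset V) (w : Sym2 V → ℝ)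
    (B : Set (Set (Sym2 V))) : ℝ :=
  (∑ t ∈ (spanningTrees G W).filter (fun t : Finset (Sym2 V) => (t : Set (Sym2 V)) ∈ B), treeWeight w t) /
    ∑ t ∈ spanningTrees G W, treeWeight w t

/-! ## The simple ladder graph -/

/-- The vertex set of the two-sided infinite ladder. -/
abbrev LadderVertex : Type := Fin 2 × ℤ

/-- The rung `z_m`. -/
def rung (m : ℤ) : Sym2 LadderVertex := s((0, m), (1, m))

/-- The horizontal edge `h_{i,m}`. -/
def rail (i : Fin 2) (m : ℤ) : Sym2 LadderVertex := s((i, m - 1), (i, m))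

/-- The simple ladder graph. -/
def ladderGraph : SimpleGraph LadderVertex :=
  SimpleGraph.fromEdgeSet {e | (∃ m, e = rung m) ∨ ∃ i m, e = rail i m}

/-- The vertices `{0,1} × {-n,…,n}`. -/
def ladderBox (n : ℕ) : Finset LadderVertex := Finset.univ ×ˢ Finset.Icc (-(n : ℤ)) n

open Classical in
/-- Rungs have weight `c`, horizontal edges have weight `1`. -/
def ladderWeight (c : ℝ) (e : Sym2 LadderVertex) : ℝ := if ∃ m, e = rung m then c else 1

/-- `P` is the limit of the weighted spanning tree measures on the finite ladders with vertex sets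
`{0,1} × {-n,…,n}`: for every finite set `F` of edges, the law of the trace of the tree on `F`
converges to the law of the trace on `F` under `P`. -/
def IsLadderTreeMeasure (c : ℝ) (P : Measure (Set (Sym2 LadderVertex))) : Prop :=
  IsProbabilityMeasure P ∧
    ∀ (F : Finset (Sym2 LadderVertex)) (S : Set (Sym2 LadderVertex)),
      Tendsto (fun n : ℕ => treeProb ladderGraph (ladderBox n) (ladderWeight c)
          {t | ∀ e ∈ F, e ∈ t ↔ e ∈ S})
        atTop (𝓝 (P.real {t | ∀ e ∈ F, e ∈ t ↔ e ∈ S}))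

open Classical in
/-- The weighted spanning tree measure on the infinite ladder, for finite rung weight `c`. (The
default value `0` is irrelevant: existence and uniqueness for `c > 0` are part of the theorem.) -/
def ladderTreeMeasure (c : ℝ) : Measure (Set (Sym2 LadderVertex)) :=
  if h : ∃ P, IsLadderTreeMeasure c P then h.choose else 0

open Classical in
/-- The configuration of the rungs: the value at `m` is `1` (`true`) iff the rung `z_m` is in
the tree `t`. -/
def rungIndicator (t : Set (Sym2 LadderVertex)) (m : ℤ) : Bool := decide (rung m ∈ t)

/-- The law on `{0,1}^ℤ` of the rung process for rung weight `c ∈ (0,∞]`; for `c = ∞` the process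
is identically `1`. -/
def rungLaw (c : ℝ≥0∞) : Measure (ℤ → Bool) :=
  if c = ∞ then Measure.dirac (fun _ => true)
  else (ladderTreeMeasure c.toReal).map rungIndicator

/-- The law of `(X_m Y_m)_m` where `X` has law `μ` and `Y` is an independent i.i.d. sequence of
Bernoulli variables with parameter `p`. -/
def thinnedLaw (p : unitInterval) (μ : Measure (ℤ → Bool)) : Measure (ℤ → Bool) :=
  (μ.prod (Measure.infinitePi fun _ : ℤ => bernoulliMeasure true false p)).map
    fun xy m => xy.1 m && xy.2 m

/-! ## Determinantal processes and renewal processes on `ℤ` -/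

/-- `μ` is the law of a determinantal point process with Hermitian matrix `A`. -/
def IsHermitianDeterminantal (μ : Measure (ℤ → Bool)) (A : Matrix ℤ ℤ ℂ) : Prop :=
  A.IsHermitian ∧
    ∀ S : Finset ℤ, ((μ.real {x | ∀ s ∈ S, x s = true} : ℝ) : ℂ) =
      (A.submatrix (fun s : S => (s : ℤ)) (fun s : S => (s : ℤ))).det

/-- The law `μ` is invariant under the shift. -/
def IsStationaryLaw (μ : Measure (ℤ → Bool)) : Prop :=
  μ.map (fun x m => x (m + 1)) = μ

/-- Given a `1` at time `0`, the future is independent of the past. (The elementary conditional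
probabilities are multiplied out, so that conditioning on null events imposes nothing.) -/
def IsRenewal (μ : Measure (ℤ → Bool)) : Prop :=
  ∀ (B : Set (Iio (0 : ℤ) → Bool)) (C : Set (Ioi (0 : ℤ) → Bool)),
    MeasurableSet B → MeasurableSet C →
    μ {x | (Ioi (0 : ℤ)).domRestrict x ∈ C ∧ (Iio (0 : ℤ)).domRestrict x ∈ B ∧ x 0 = true} *
        μ {x | x 0 = true} =
      μ {x | (Ioi (0 : ℤ)).domRestrict x ∈ C ∧ x 0 = true} *
        μ {x | (Iio (0 : ℤ)).domRestrict x ∈ B ∧ x 0 = true}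

/-- The Fourier coefficient `∫₀¹ f(x) e^{-2πikx} dx`. -/
def fourierHat (f : ℝ → ℝ) (k : ℤ) : ℂ :=
  ∫ x in (0 : ℝ)..1, (f x : ℂ) * Complex.exp (-2 * Real.pi * Complex.I * k * x)

/-- `f` is the Fourier transform of the Toeplitz matrix `A`: `f` is a measurable function from
`[0,1]` to `[0,1]` whose Fourier coefficients are the entries of `A`. -/
def IsFourierTransform (f : ℝ → ℝ) (A : Matrix ℤ ℤ ℂ) : Prop :=
  Measurable f ∧ (∀ x ∈ Icc (0 : ℝ) 1, f x ∈ Icc (0 : ℝ) 1) ∧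
    ∀ k l, A k l = fourierHat f (l - k)

/-! ## The parameters -/

/-- The rung weight `c ∈ (0,∞]` belonging to `α ∈ [0,1)`. -/
def rungWeight (α : ℝ) : ℝ≥0∞ :=
  if α = 0 then ∞ else ENNReal.ofReal ((1 - α) ^ 2 / (2 * α))

/-- The function `c / (c + 1 - cos 2πx)`, read as `1` for `c = ∞`. -/
def ladderSymbol (c : ℝ≥0∞) (x : ℝ) : ℝ :=
  if c = ∞ then 1 else c.toReal / (c.toReal + 1 - Real.cos (2 * Real.pi * x))

/-- The matrix with entries `(1-α)/(1+α) · α^|l-k|`. -/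
def ladderKernel (α : ℝ) : Matrix ℤ ℤ ℂ :=
  Matrix.of fun k l => (((1 - α) / (1 + α) * α ^ (l - k).natAbs : ℝ) : ℂ)

end

/-!
The argument has three independent parts, which meet in the notion of a law with *geometric
correlations* (`GeomCorr μ κ α`): the density is `κ`, and adjoining to a finite set of occupied sites
a further one at distance `d` to the right multiplies the probability by `κ (1 - α ^ (2 d))`. Such a
law is unique (`GeomCorr.ext`), hence stationary. Correlations that factorize in this way at every
occupied site make it a renewal process (`GeomCorr.isRenewal`). By a row operation the principal
minors of `κ α ^ |k - l|` obey the same recursion (`GeomCorr.isHermitianDeterminantal`), and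
independent thinning only rescales `κ`. Decomposing at the last occupied site of `[0, n]` shows that
the probabilities of holes after an occupied site satisfy a linear recurrence of order two
(`GeomCorr.hole_recurrence`). For `κ = (1 - α) / (1 + α)` its characteristic polynomial is
`(z - α) ^ 2`, which gives the law of the return time; for larger `κ` it has no root on the positive
axis, which is incompatible with nonnegative probabilities (`GeomCorr.density_le`).

*Spanning trees of the ladder.* Scanning the ladder from left to right, an edge set that can still
be completed to a spanning tree is in one of two states: it is a spanning tree so far, or it has two
components, which contain the two vertices of the last column. The weighted numbers of such sets
evolve by a `2 × 2` transfer matrix (`treeSum_splitSum_succ`), which for the full tree sum has the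
eigenvalues `1 / α` and `α`. Restricting the matrices of finitely many columns encodes cylinder
events, so by the Perron projection all cylinder probabilities converge
(`exists_tendsto_treeProb`); compactness of the space of probability measures yields the limit
measure. The matrix of a column whose rung is present has rank one, so that the rung process has
geometric correlations with `κ = (1 - α) / (1 + α)` (`geomCorr_rungs`).

*The classification.* For a stationary determinantal renewal process of density `ρ`, comparing the
determinant for `i < j < k` with the renewal property expresses `Re (A i j * A j k * A k i)` through
the moduli of the three entries, and the inequality of arithmetic and geometric means forces
`ρ ^ 2 |A i k| ^ 2 = |A i j| ^ 2 |A j k| ^ 2` (`normSq_mul_normSq`). Hence `|A k l| = ρ α ^ |k - l|`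
for some `α`, the process has geometric correlations, and the bound on `κ` above says that the
retention probability `p = ρ (1 + α) / (1 - α)` is at most `1`.
-/

/-! ### Correlation functions of binary configurations -/

/-- The cylinder event that a binary configuration equals `1` at every point of `S`. -/
def onesOn {ι : Type*} (S : Finset ι) : Set (ι → Bool) := {x | ∀ s ∈ S, x s = true}

lemma onesOn_empty {ι : Type*} : onesOn (∅ : Finset ι) = univ := by simp [onesOn]

lemma onesOn_insert {ι : Type*} [DecidableEq ι] (a : ι) (S : Finset ι) :
    onesOn (insert a S) = {x | x a = true} ∩ onesOn S := by
  ext x; simp [onesOn]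

lemma onesOn_singleton {ι : Type*} (a : ι) :
    onesOn {a} = {x : ι → Bool | x a = true} := by
  ext x; simp [onesOn]

lemma measurableSet_apply_eq {ι : Type*} (a : ι) (b : Bool) :
    MeasurableSet {x : ι → Bool | x a = b} :=
  measurableSet_eq_fun (measurable_pi_apply a) measurable_const

lemma measurableSet_onesOn {ι : Type*} (S : Finset ι) : MeasurableSet (onesOn S) := by
  classical
  induction S using Finset.induction_on with
  | empty => simp [onesOn_empty]
  | insert a S _ ih => rw [onesOn_insert]; exact (measurableSet_apply_eq a true).inter ih

lemma generateFrom_onesOn {ι : Type*} :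
    (MeasurableSpace.pi : MeasurableSpace (ι → Bool)) =
      MeasurableSpace.generateFrom (range onesOn) := by
  apply le_antisymm
  · refine iSup_le fun a => ?_
    rw [← measurable_iff_comap_le]
    refine @measurable_to_bool _ (MeasurableSpace.generateFrom (range onesOn)) _ ?_
    exact MeasurableSpace.measurableSet_generateFrom ⟨{a}, onesOn_singleton a⟩
  · refine MeasurableSpace.generateFrom_le ?_
    rintro _ ⟨S, rfl⟩
    exact measurableSet_onesOn S

/-- A finite measure on binary configurations is determined by its correlation functions, since
the events `onesOn S` form a generating π-system. -/
lemma ext_of_onesOn {ι : Type*} {μ ν : Measure (ι → Bool)} [IsFiniteMeasure μ]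
    (h : ∀ S : Finset ι, μ (onesOn S) = ν (onesOn S)) : μ = ν := by
  classical
  refine ext_of_generate_finite _ generateFrom_onesOn ?_ ?_ ?_
  · rintro _ ⟨S, rfl⟩ _ ⟨T, rfl⟩ -
    refine ⟨S ∪ T, ?_⟩
    ext x
    simp only [onesOn, Finset.mem_union, mem_ofPred_eq, mem_inter_iff]
    grind
  · rintro _ ⟨S, rfl⟩
    exact h S
  · simpa [onesOn_empty] using h ∅

/-! ### Processes with geometric correlations -/

/-- The law `μ` has one-point density `κ`, and adjoining to `S` a point `a` at distance `d` to the
right of `max S` multiplies the probability of seeing ones on `S` by `κ (1 - α ^ (2 d))`. These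
rules determine all correlation functions; they are those of the determinantal process with kernel
`κ α ^ |k - l|`. -/
structure GeomCorr (μ : Measure (ℤ → Bool)) (κ α : ℝ) : Prop where
  prob : IsProbabilityMeasure μ
  single : ∀ a, μ.real (onesOn {a}) = κ
  step : ∀ (S : Finset ℤ) (a b : ℤ), b ∈ S → (∀ s ∈ S, s ≤ b) → b < a →
    μ.real (onesOn (insert a S)) = μ.real (onesOn S) * (κ * (1 - α ^ (2 * (a - b).toNat)))

/-- Induction on a finite set of integers by adjoining points on the right, which also provides the
largest point so far. -/
lemma Finset.induction_right {motive : Finset ℤ → Prop} (S : Finset ℤ) (empty : motive ∅)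
    (single : ∀ a, motive {a})
    (step : ∀ (S : Finset ℤ) (a b : ℤ), b ∈ S → (∀ s ∈ S, s ≤ b) → b < a → motive S →
      motive (insert a S)) : motive S := by
  induction S using Finset.induction_on_max with
  | empty => exact empty
  | insert a S h ih =>
    rcases S.eq_empty_or_nonempty with rfl | hS
    · simpa using single a
    · exact step S a (S.max' hS) (S.max'_mem hS) (fun s hs => S.le_max' s hs)
        (h _ (S.max'_mem hS)) ih

lemma real_onesOn_empty {ι : Type*} (μ : Measure (ι → Bool)) [IsProbabilityMeasure μ] :
    μ.real (onesOn ∅) = 1 := by simp [onesOn_empty]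

lemma GeomCorr.ext {μ ν : Measure (ℤ → Bool)} {κ α : ℝ} (hμ : GeomCorr μ κ α)
    (hν : GeomCorr ν κ α) : μ = ν := by
  have := hμ.prob
  have := hν.prob
  refine ext_of_onesOn fun S => ?_
  rw [← measureReal_eq_measureReal_iff]
  induction S using Finset.induction_right with
  | empty => simp [real_onesOn_empty]
  | single a => rw [hμ.single, hν.single]
  | step S a b hb hS hab ih => rw [hμ.step S a b hb hS hab, hν.step S a b hb hS hab, ih]

lemma measurable_shift (j : ℤ) : Measurable (fun (x : ℤ → Bool) m => x (m + j)) :=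
  measurable_pi_lambda _ fun m => measurable_pi_apply (m + j)

lemma preimage_shift_onesOn (j : ℤ) (S : Finset ℤ) :
    (fun (x : ℤ → Bool) m => x (m + j)) ⁻¹' onesOn S = onesOn (S.image (· + j)) := by
  ext x
  simp only [onesOn, mem_preimage, mem_ofPred_eq, Finset.forall_mem_image]

lemma GeomCorr.isStationaryLaw {μ : Measure (ℤ → Bool)} {κ α : ℝ} (hμ : GeomCorr μ κ α) :
    IsStationaryLaw μ := by
  have := hμ.prob
  refine GeomCorr.ext (κ := κ) (α := α) ⟨?_, ?_, ?_⟩ hμ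
  · exact Measure.isProbabilityMeasure_map (measurable_shift 1).aemeasurable
  · intro a
    rw [map_measureReal_apply (measurable_shift 1) (measurableSet_onesOn _),
      preimage_shift_onesOn, Finset.image_singleton, hμ.single]
  · intro S a b hb hS hab
    rw [map_measureReal_apply (measurable_shift 1) (measurableSet_onesOn _),
      map_measureReal_apply (measurable_shift 1) (measurableSet_onesOn _),
      preimage_shift_onesOn, preimage_shift_onesOn, Finset.image_insert,
      hμ.step (S.image (· + 1)) (a + 1) (b + 1) (Finset.mem_image_of_mem _ hb)
        (by simpa only [Finset.forall_mem_image, add_le_add_iff_right] using hS) (by lia)]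
    simp only [add_sub_add_right_eq_sub]

lemma IsStationaryLaw.map_shift {μ : Measure (ℤ → Bool)} (hμ : IsStationaryLaw μ) (j : ℤ) :
    μ.map (fun x m => x (m + j)) = μ := by
  have hadd : ∀ i j : ℤ, (μ.map (fun x m => x (m + i))).map (fun x m => x (m + j)) =
      μ.map (fun x m => x (m + (i + j))) := by
    intro i j
    rw [Measure.map_map (measurable_shift j) (measurable_shift i)]
    congr 1
    funext x m
    simp only [Function.comp_apply]
    congr 1
    ring
  have hnat : ∀ n : ℕ, μ.map (fun x m => x (m + n)) = μ := by
    intro n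
    induction n with
    | zero => simp
    | succ n ih =>
      have := hadd n 1
      rw [ih, hμ] at this
      rw [Nat.cast_succ]
      exact this.symm
  obtain ⟨n, rfl | rfl⟩ := j.eq_nat_or_neg
  · exact hnat n
  · have := hadd n (-n)
    rw [hnat n] at this
    rw [this]
    simp

lemma IsStationaryLaw.measure_shift {μ : Measure (ℤ → Bool)} (hμ : IsStationaryLaw μ) (j : ℤ)
    {E : Set (ℤ → Bool)} (hE : MeasurableSet E) : μ {x | (fun m => x (m + j)) ∈ E} = μ E := by
  conv_rhs => rw [← hμ.map_shift j, Measure.map_apply (measurable_shift j) hE]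
  rfl

lemma IsStationaryLaw.real_shift {μ : Measure (ℤ → Bool)} (hμ : IsStationaryLaw μ) (j : ℤ)
    {E : Set (ℤ → Bool)} (hE : MeasurableSet E) :
    μ.real {x | (fun m => x (m + j)) ∈ E} = μ.real E := by
  rw [measureReal_def, measureReal_def, hμ.measure_shift j hE]

/-- Correlation functions factorize at `0`. -/
lemma GeomCorr.real_onesOn_union {μ : Measure (ℤ → Bool)} {κ α : ℝ} (hμ : GeomCorr μ κ α)
    (S T : Finset ℤ) (hS : ∀ s ∈ S, s < 0) (hT : ∀ s ∈ T, 0 < s) :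
    μ.real (onesOn (T ∪ insert 0 S)) * κ =
      μ.real (onesOn (insert 0 T)) * μ.real (onesOn (insert 0 S)) := by
  revert hT
  induction T using Finset.induction_right with
  | empty =>
    intro _
    rw [Finset.empty_union, LawfulSingleton.insert_empty_eq, hμ.single, mul_comm]
  | single a =>
    intro h
    have ha : 0 < a := h a (by simp)
    have h1 := hμ.step (insert 0 S) a 0 (by simp)
      (by simp only [Finset.mem_insert]; rintro s (rfl | h); exacts [le_rfl, (hS s h).le]) ha
    have h2 := hμ.step {0} a 0 (by simp) (by simp) ha
    rw [Finset.singleton_union, h1, Finset.pair_comm, h2, hμ.single]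
    ring
  | step T a b hb hbT hab ih =>
    intro h
    have hT : ∀ s ∈ T, 0 < s := fun s hs => h s (by simp [hs])
    have h1 := hμ.step (T ∪ insert 0 S) a b (by simp [hb])
      (by
        simp only [Finset.mem_union, Finset.mem_insert]
        rintro s (h | rfl | h)
        exacts [hbT s h, (hT b hb).le, (hS s h).le.trans (hT b hb).le]) hab
    have h2 := hμ.step (insert 0 T) a b (by simp [hb])
      (by
        simp only [Finset.mem_insert]
        rintro s (rfl | h)
        exacts [(hT b hb).le, hbT s h]) hab
    rw [Finset.insert_union, h1, Finset.insert_comm, h2]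
    linear_combination (κ * (1 - α ^ (2 * (a - b).toNat))) * ih hT

lemma measurable_domRestrict (I : Set ℤ) : Measurable (I.domRestrict : (ℤ → Bool) → I → Bool) :=
  measurable_pi_lambda _ fun m => measurable_pi_apply (m : ℤ)

lemma GeomCorr.isRenewal {μ : Measure (ℤ → Bool)} {κ α : ℝ} (hμ : GeomCorr μ κ α) :
    IsRenewal μ := by
  classical
  have := hμ.prob
  -- finite measures that agree on correlations agree on the restricted σ-algebra
  have key : ∀ (I : Set ℤ) (E F : Set (ℤ → Bool)) (a b : ℝ≥0∞), MeasurableSet E →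
      MeasurableSet F → a ≠ ∞ →
      (∀ S : Finset ℤ, (∀ s ∈ S, s ∈ I) → μ (onesOn S ∩ E) * a = μ (onesOn S ∩ F) * b) →
      ∀ B : Set (I → Bool), MeasurableSet B →
        μ (I.domRestrict ⁻¹' B ∩ E) * a = μ (I.domRestrict ⁻¹' B ∩ F) * b := by
    intro I E F a b hE hF ha h B hB
    have hfin : IsFiniteMeasure (a • (μ.restrict E).map (I.domRestrict : (ℤ → Bool) → I → Bool)) :=
      Measure.smul_finite _ ha
    have : a • (μ.restrict E).map (I.domRestrict : (ℤ → Bool) → I → Bool) =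
        b • (μ.restrict F).map I.domRestrict := by
      refine ext_of_onesOn fun S => ?_
      have hpre : (I.domRestrict : (ℤ → Bool) → I → Bool) ⁻¹' onesOn S =
          onesOn (S.image (fun s : I => (s : ℤ))) := by
        ext x; simp [onesOn]
      have := h (S.image (fun s : I => (s : ℤ))) (by simp +contextual)
      simp only [Measure.smul_apply, smul_eq_mul]
      rw [Measure.map_apply (measurable_domRestrict I) (measurableSet_onesOn S),
        Measure.map_apply (measurable_domRestrict I) (measurableSet_onesOn S), hpre,
        Measure.restrict_apply (measurableSet_onesOn _),
        Measure.restrict_apply (measurableSet_onesOn _), mul_comm, this, mul_comm]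
    have h2 := congrArg (fun ρ => ρ B) this
    simp only [Measure.smul_apply, smul_eq_mul] at h2
    rw [Measure.map_apply (measurable_domRestrict I) hB,
      Measure.map_apply (measurable_domRestrict I) hB,
      Measure.restrict_apply (measurable_domRestrict I hB),
      Measure.restrict_apply (measurable_domRestrict I hB)] at h2
    rw [mul_comm, h2, mul_comm]
  have h0 : MeasurableSet {x : ℤ → Bool | x 0 = true} := measurableSet_apply_eq 0 true
  -- the future event is a cylinder, the past event is arbitrary
  have hfuture : ∀ T : Finset ℤ, (∀ s ∈ T, s ∈ Ioi (0 : ℤ)) → ∀ B : Set (Iio (0 : ℤ) → Bool),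
      MeasurableSet B →
      μ ((Iio (0 : ℤ)).domRestrict ⁻¹' B ∩ (onesOn T ∩ {x | x 0 = true})) * μ {x | x 0 = true} =
        μ ((Iio (0 : ℤ)).domRestrict ⁻¹' B ∩ {x | x 0 = true}) *
          μ (onesOn T ∩ {x | x 0 = true}) := by
    intro T hT B hB
    refine key _ _ _ _ _ ((measurableSet_onesOn T).inter h0) h0 (measure_ne_top _ _) ?_ B hB
    intro S hS
    have := hμ.real_onesOn_union S T hS hT
    have e1 : onesOn (T ∪ insert 0 S) = onesOn S ∩ (onesOn T ∩ {x : ℤ → Bool | x 0 = true}) := by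
      ext x
      simp only [onesOn, Finset.mem_union, Finset.mem_insert, mem_ofPred_eq, mem_inter_iff]
      grind
    have e2 : ∀ S : Finset ℤ, onesOn (insert 0 S) = onesOn S ∩ {x : ℤ → Bool | x 0 = true} := by
      intro S
      rw [onesOn_insert, inter_comm]
    rw [← hμ.single 0, e1, e2, e2, onesOn_singleton] at this
    rw [← ENNReal.toReal_eq_toReal_iff' (by finiteness) (by finiteness), ENNReal.toReal_mul,
      ENNReal.toReal_mul]
    simp only [measureReal_def] at this
    rw [this, mul_comm]
  intro B C hB hC
  have := key (Ioi 0) ((Iio (0 : ℤ)).domRestrict ⁻¹' B ∩ {x : ℤ → Bool | x 0 = true})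
    {x : ℤ → Bool | x 0 = true} (μ {x | x 0 = true})
    (μ ((Iio (0 : ℤ)).domRestrict ⁻¹' B ∩ {x | x 0 = true}))
    ((measurable_domRestrict _ hB).inter h0) h0 (measure_ne_top _ _)
    (by
      intro T hT
      rw [inter_left_comm, hfuture T hT B hB, mul_comm]) C hC
  exact this

/-! ### Determinants of the geometric kernel -/

/-- If row `a` is, on the columns of `S`, a multiple `t` of row `b ∈ S`, then the minor on
`insert a S` reduces to the minor on `S` by a row operation. -/
lemma det_insert_of_row {ι R : Type*} [DecidableEq ι] [CommRing R] (A : Matrix ι ι R)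
    (S : Finset ι) (a b : ι) (ha : a ∉ S) (hb : b ∈ S) (t : R) (h : ∀ j ∈ S, A a j = t * A b j) :
    (A.submatrix (fun s : (insert a S : Finset ι) => (s : ι))
      (fun s : (insert a S : Finset ι) => (s : ι))).det =
      (A a a - t * A b a) * (A.submatrix (fun s : S => (s : ι)) (fun s : S => (s : ι))).det := by
  let e : S ⊕ Unit ≃ (insert a S : Finset ι) :=
    (Equiv.optionEquivSumPUnit _).symm.trans (Finset.subtypeInsertEquivOption ha).symm
  rw [← Matrix.det_submatrix_equiv_self e, Matrix.submatrix_submatrix]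
  let f : S ⊕ Unit → ι := Sum.elim (fun s => (s : ι)) (fun _ => a)
  have hf : (fun s : (insert a S : Finset ι) => (s : ι)) ∘ e = f := by
    funext s
    rcases s with s | s <;> rfl
  rw [hf, ← Matrix.det_updateRow_add_smul_self (A.submatrix f f)
    (i := Sum.inr ()) (j := Sum.inl ⟨b, hb⟩) (by simp) (-t)]
  have : (A.submatrix f f).updateRow (Sum.inr ())
      (A.submatrix f f (Sum.inr ()) + -t • A.submatrix f f (Sum.inl ⟨b, hb⟩)) =
      Matrix.fromBlocks (A.submatrix (fun s : S => (s : ι)) (fun s : S => (s : ι)))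
        (Matrix.of fun s _ => A s a) 0 (Matrix.of fun _ _ => A a a - t * A b a) := by
    ext i j
    rcases i with i | ⟨⟩ <;> rcases j with j | ⟨⟩
    · simp [f, Matrix.updateRow_apply]
    · simp [f, Matrix.updateRow_apply]
    · simp [f, h j j.2]
    · simp [f, sub_eq_add_neg]
  rw [this, Matrix.det_fromBlocks_zero₂₁, mul_comm]
  simp

lemma ladderKernel_isHermitian (α : ℝ) : (ladderKernel α).IsHermitian := by
  ext k l
  simp only [ladderKernel, Matrix.conjTranspose_apply, Matrix.of_apply, Complex.star_def,
    Complex.conj_ofReal]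
  rw [← Int.natAbs_neg, neg_sub]

lemma GeomCorr.isHermitianDeterminantal {μ : Measure (ℤ → Bool)} {α p : ℝ}
    (hμ : GeomCorr μ (p * ((1 - α) / (1 + α))) α) :
    IsHermitianDeterminantal μ ((p : ℂ) • ladderKernel α) := by
  have := hμ.prob
  refine ⟨?_, fun S => ?_⟩
  · ext k l
    have := congrFun (congrFun (ladderKernel_isHermitian α) k) l
    simp only [Matrix.conjTranspose_apply, Matrix.smul_apply, smul_eq_mul, star_mul',
      Complex.star_def, Complex.conj_ofReal] at this ⊢
    rw [this]
  change ((μ.real (onesOn S) : ℝ) : ℂ) = _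
  induction S using Finset.induction_right with
  | empty => simp [real_onesOn_empty]
  | single a =>
    rw [hμ.single, Matrix.det_unique]
    have : (default : ({a} : Finset ℤ)) = ⟨a, by simp⟩ := Subsingleton.elim _ _
    simp [ladderKernel]
  | step S a b hb hS hab ih =>
    have ha : a ∉ S := fun h => absurd (hS a h) (by lia)
    rw [hμ.step S a b hb hS hab, Complex.ofReal_mul, ih,
      det_insert_of_row _ S a b ha hb ((α : ℂ) ^ (a - b).toNat) ?_, mul_comm]
    · congr 1
      have h1 : (a - b).natAbs = (a - b).toNat := by lia
      simp [ladderKernel, h1]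
      ring
    · intro j hj
      have h1 : (j - a).natAbs = (a - b).toNat + (j - b).natAbs := by
        have := hS j hj
        lia
      simp [ladderKernel, h1, pow_add]
      ring

/-! ### Independent thinning -/

lemma infinitePi_bernoulli_onesOn (p : unitInterval) (S : Finset ℤ) :
    (Measure.infinitePi fun _ : ℤ => bernoulliMeasure true false p).real (onesOn S) =
      (p : ℝ) ^ S.card := by
  have : onesOn S = (S : Set ℤ).pi fun _ : ℤ => {true} := by
    ext x; simp [onesOn, Set.mem_pi]
  rw [measureReal_def, this, Measure.infinitePi_pi _ (fun _ _ => MeasurableSet.singleton _),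
    Finset.prod_const, ENNReal.toReal_pow, ← measureReal_def,
    bernoulliMeasure_real_apply_of_mem_of_notMem p (MeasurableSet.singleton _) (by simp) (by simp)]

lemma measurable_thinning :
    Measurable (fun (xy : (ℤ → Bool) × (ℤ → Bool)) m => xy.1 m && xy.2 m) := by
  refine measurable_pi_lambda _ fun m => ?_
  have h : Measurable (fun b : Bool × Bool => b.1 && b.2) := measurable_of_countable _
  have h1 : Measurable (fun xy : (ℤ → Bool) × (ℤ → Bool) => (xy.1 m, xy.2 m)) :=
    ((measurable_pi_apply m).comp measurable_fst).prodMk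
      ((measurable_pi_apply m).comp measurable_snd)
  exact h.comp h1

lemma thinnedLaw_onesOn (p : unitInterval) (μ : Measure (ℤ → Bool)) [IsProbabilityMeasure μ]
    (S : Finset ℤ) :
    (thinnedLaw p μ).real (onesOn S) = μ.real (onesOn S) * (p : ℝ) ^ S.card := by
  have : (fun (xy : (ℤ → Bool) × (ℤ → Bool)) m => xy.1 m && xy.2 m) ⁻¹' onesOn S =
      onesOn S ×ˢ onesOn S := by
    ext ⟨x, y⟩
    simp only [onesOn, mem_preimage, mem_ofPred_eq, Bool.and_eq_true, mem_prod]
    grind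
  rw [thinnedLaw, map_measureReal_apply measurable_thinning (measurableSet_onesOn S), this,
    measureReal_prod_prod, infinitePi_bernoulli_onesOn]

instance (p : unitInterval) (μ : Measure (ℤ → Bool)) [IsProbabilityMeasure μ] :
    IsProbabilityMeasure (thinnedLaw p μ) :=
  Measure.isProbabilityMeasure_map measurable_thinning.aemeasurable

lemma GeomCorr.thinnedLaw {μ : Measure (ℤ → Bool)} {κ α : ℝ} (hμ : GeomCorr μ κ α)
    (p : unitInterval) : GeomCorr (thinnedLaw p μ) (p * κ) α := by
  have := hμ.prob
  refine ⟨inferInstance, fun a => ?_, fun S a b hb hS hab => ?_⟩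
  · rw [thinnedLaw_onesOn, hμ.single]
    simp [mul_comm]
  · have ha : a ∉ S := fun h => absurd (hS a h) (by lia)
    rw [thinnedLaw_onesOn, thinnedLaw_onesOn, hμ.step S a b hb hS hab,
      Finset.card_insert_of_notMem ha]
    ring

/-- The process that is identically `1`. -/
lemma geomCorr_dirac : GeomCorr (Measure.dirac fun _ => true) 1 0 := by
  have h : ∀ S : Finset ℤ, (Measure.dirac fun _ => true).real (onesOn S) = 1 := by
    intro S
    rw [measureReal_def, Measure.dirac_apply' _ (measurableSet_onesOn S)]
    simp [onesOn]
  refine ⟨inferInstance, fun a => h _, fun S a b hb hS hab => ?_⟩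
  rw [h, h, zero_pow (by lia)]
  simp

/-! ### Holes -/

/-- The event that `0` is occupied and the next `n` sites are empty. -/
def holeEvent (n : ℕ) : Set (ℤ → Bool) :=
  {x | x 0 = true ∧ ∀ k : ℕ, 1 ≤ k → k ≤ n → x (k : ℤ) = false}

lemma measurableSet_forall_false (p : ℕ → Prop) :
    MeasurableSet {x : ℤ → Bool | ∀ k : ℕ, p k → x (k : ℤ) = false} := by
  have : {x : ℤ → Bool | ∀ k : ℕ, p k → x (k : ℤ) = false} =
      ⋂ (k : ℕ) (_ : p k), {x : ℤ → Bool | x (k : ℤ) = false} := by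
    ext x; simp
  rw [this]
  exact MeasurableSet.iInter fun k => MeasurableSet.iInter fun _ => measurableSet_apply_eq _ _

lemma measurableSet_holeEvent (n : ℕ) : MeasurableSet (holeEvent n) := by
  have : holeEvent n = {x | x 0 = true} ∩
      {x | ∀ k : ℕ, (1 ≤ k ∧ k ≤ n) → x (k : ℤ) = false} := by
    ext x; simp [holeEvent]
  rw [this]
  exact (measurableSet_apply_eq _ _).inter (measurableSet_forall_false _)

/-- The event that `0` and `j` are occupied, and that no site of `(j, n]` is. -/
def lastOneEvent (n j : ℕ) : Set (ℤ → Bool) :=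
  {x | x 0 = true ∧ x (j : ℤ) = true ∧ ∀ k : ℕ, j < k → k ≤ n → x (k : ℤ) = false}

lemma measurableSet_lastOneEvent (n j : ℕ) : MeasurableSet (lastOneEvent n j) := by
  have : lastOneEvent n j = {x | x 0 = true} ∩ ({x | x (j : ℤ) = true} ∩
      {x | ∀ k : ℕ, (j < k ∧ k ≤ n) → x (k : ℤ) = false}) := by
    ext x; simp [lastOneEvent]
  rw [this]
  exact (measurableSet_apply_eq _ _).inter ((measurableSet_apply_eq _ _).inter
    (measurableSet_forall_false _))

lemma sum_lastOneEvent (μ : Measure (ℤ → Bool)) [IsProbabilityMeasure μ] (n : ℕ) :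
    ∑ j ∈ Finset.range (n + 1), μ.real (lastOneEvent n j) = μ.real {x | x 0 = true} := by
  rw [← measureReal_biUnion_finset]
  · congr 1
    ext x
    simp only [mem_iUnion, Finset.mem_range, exists_prop, lastOneEvent, mem_ofPred_eq]
    refine ⟨fun ⟨j, _, h, _⟩ => h, fun h => ?_⟩
    refine ⟨Nat.findGreatest (fun j => x (j : ℤ) = true) n, ?_, h, ?_, ?_⟩
    · exact Nat.lt_succ_of_le (Nat.findGreatest_le n)
    · exact Nat.findGreatest_spec (P := fun j : ℕ => x (j : ℤ) = true) (Nat.zero_le n) (by simpa)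
    · intro k hk hkn
      exact Bool.eq_false_iff.mpr (Nat.findGreatest_is_greatest hk hkn)
  · intro i hi j hj hij
    rw [Function.onFun, Set.disjoint_left]
    rintro x ⟨_, h1, h2⟩ ⟨_, h3, h4⟩
    simp only [Finset.coe_range, mem_Iio] at hi hj
    rcases lt_or_gt_of_ne hij with h | h
    · have := h2 j h (by lia)
      rw [h3] at this
      exact absurd this (by simp)
    · have := h4 i h (by lia)
      rw [h1] at this
      exact absurd this (by simp)
  · exact fun j _ => measurableSet_lastOneEvent n j

lemma IsRenewal.real_mul_zero {μ : Measure (ℤ → Bool)} (hr : IsRenewal μ)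
    {U V : Set (ℤ → Bool)} (hU : MeasurableSet U) (hV : MeasurableSet V)
    (hU' : ∀ x y : ℤ → Bool, (∀ m < 0, x m = y m) → x ∈ U → y ∈ U)
    (hV' : ∀ x y : ℤ → Bool, (∀ m > 0, x m = y m) → x ∈ V → y ∈ V) :
    μ.real (V ∩ (U ∩ {x | x 0 = true})) * μ.real {x | x 0 = true} =
      μ.real (V ∩ {x | x 0 = true}) * μ.real (U ∩ {x | x 0 = true}) := by
  classical
  let ext : ∀ I : Set ℤ, (I → Bool) → ℤ → Bool := fun I y m =>
    if h : m ∈ I then y ⟨m, h⟩ else false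
  have hext : ∀ I, Measurable (ext I) := fun I => by
    refine measurable_pi_lambda _ fun m => ?_
    by_cases h : m ∈ I
    · simpa [ext, h] using measurable_pi_apply (⟨m, h⟩ : I)
    · simp [ext, h]
  have eU : ∀ x : ℤ → Bool, (Iio (0 : ℤ)).domRestrict x ∈ ext (Iio 0) ⁻¹' U ↔ x ∈ U := fun x =>
    ⟨hU' _ _ fun m hm => by simp [ext, hm, Set.domRestrict],
      hU' _ _ fun m hm => by simp [ext, hm, Set.domRestrict]⟩
  have eV : ∀ x : ℤ → Bool, (Ioi (0 : ℤ)).domRestrict x ∈ ext (Ioi 0) ⁻¹' V ↔ x ∈ V := fun x =>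
    ⟨hV' _ _ fun m hm => by simp [ext, hm, Set.domRestrict],
      hV' _ _ fun m hm => by simp [ext, hm, Set.domRestrict]⟩
  have h := congrArg ENNReal.toReal
    (hr (ext (Iio 0) ⁻¹' U) (ext (Ioi 0) ⁻¹' V) (hext _ hU) (hext _ hV))
  simp only [eU, eV, ENNReal.toReal_mul] at h
  exact h

/-- For a stationary renewal process, past and future of any site `j` are independent given that
`j` is occupied. -/
lemma IsRenewal.real_mul {μ : Measure (ℤ → Bool)} (hr : IsRenewal μ) (hs : IsStationaryLaw μ)
    (j : ℤ) {U V : Set (ℤ → Bool)} (hU : MeasurableSet U) (hV : MeasurableSet V)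
    (hU' : ∀ x y : ℤ → Bool, (∀ m < j, x m = y m) → x ∈ U → y ∈ U)
    (hV' : ∀ x y : ℤ → Bool, (∀ m > j, x m = y m) → x ∈ V → y ∈ V) :
    μ.real (V ∩ (U ∩ {x | x j = true})) * μ.real {x | x j = true} =
      μ.real (V ∩ {x | x j = true}) * μ.real (U ∩ {x | x j = true}) := by
  have hj : MeasurableSet {x : ℤ → Bool | x j = true} := measurableSet_apply_eq j true
  have h := hr.real_mul_zero (measurable_shift (-j) hU) (measurable_shift (-j) hV)
    (fun x y hxy => hU' _ _ fun m hm => hxy _ (by lia))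
    (fun x y hxy => hV' _ _ fun m hm => hxy _ (by lia))
  have e : {x : ℤ → Bool | x 0 = true} =
      (fun (x : ℤ → Bool) m => x (m + -j)) ⁻¹' {x | x j = true} := by
    ext x; simp
  rw [e, ← preimage_inter, ← preimage_inter, ← preimage_inter] at h
  rwa [← hs.real_shift (-j) (hV.inter (hU.inter hj)), ← hs.real_shift (-j) hj,
    ← hs.real_shift (-j) (hV.inter hj), ← hs.real_shift (-j) (hU.inter hj)]

lemma real_lastOneEvent_mul {μ : Measure (ℤ → Bool)} (hs : IsStationaryLaw μ) (hr : IsRenewal μ)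
    {n j : ℕ} (hj : 1 ≤ j) :
    μ.real (lastOneEvent n j) * μ.real {x | x 0 = true} =
      μ.real (onesOn {0, (j : ℤ)}) * μ.real (holeEvent (n - j)) := by
  have h := hr.real_mul hs j (measurableSet_apply_eq 0 true)
    (measurableSet_forall_false (fun k => j < k ∧ k ≤ n))
    (fun x y hxy hx => by
      have := hxy 0 (by lia)
      simp only [mem_ofPred_eq] at hx ⊢
      rw [← this, hx])
    (fun x y hxy hx k hk => by
      rw [← hxy k (by lia)]
      exact hx k hk)
  have e1 : {x : ℤ → Bool | ∀ k : ℕ, (j < k ∧ k ≤ n) → x (k : ℤ) = false} ∩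
      ({x | x 0 = true} ∩ {x | x (j : ℤ) = true}) = lastOneEvent n j := by
    ext x
    simp only [lastOneEvent, mem_inter_iff, mem_ofPred_eq]
    grind
  have e2 : {x : ℤ → Bool | x (j : ℤ) = true} =
      {x | (fun m => x (m + j)) ∈ {x : ℤ → Bool | x 0 = true}} := by
    ext x; simp
  have e3 : {x : ℤ → Bool | ∀ k : ℕ, (j < k ∧ k ≤ n) → x (k : ℤ) = false} ∩
      {x | x (j : ℤ) = true} = {x | (fun m => x (m + j)) ∈ holeEvent (n - j)} := by
    ext x
    simp only [holeEvent, mem_inter_iff, mem_ofPred_eq, zero_add]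
    rw [and_comm]
    refine and_congr_right fun _ => ⟨fun h k h1 h2 => ?_, fun h k hk => ?_⟩
    · have := h (k + j) (by lia)
      rwa [Nat.cast_add] at this
    · have := h (k - j) (by lia) (by lia)
      rwa [Nat.cast_sub hk.1.le, sub_add_cancel] at this
  have e4 : {x : ℤ → Bool | x 0 = true} ∩ {x | x (j : ℤ) = true} = onesOn {0, (j : ℤ)} := by
    ext x; simp [onesOn]
  rw [e1, e3, e4, hs.real_shift j (measurableSet_holeEvent _), e2,
    hs.real_shift j (measurableSet_apply_eq 0 true)] at h
  rw [h, mul_comm]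

/-- Decomposing at the last occupied site of `[0, n]` gives the renewal equation for the hole
probabilities. -/
lemma GeomCorr.renewal_equation {μ : Measure (ℤ → Bool)} {κ α : ℝ} (hμ : GeomCorr μ κ α)
    (hκ : κ ≠ 0) (n : ℕ) :
    μ.real (holeEvent n) + κ * ∑ j ∈ Finset.range (n + 1),
      (1 - α ^ (2 * j)) * μ.real (holeEvent (n - j)) = κ := by
  have := hμ.prob
  have h0 := hμ.single 0
  rw [onesOn_singleton] at h0
  have hsum := sum_lastOneEvent μ n
  rw [Finset.sum_range_succ', h0] at hsum
  have hz : lastOneEvent n 0 = holeEvent n := by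
    ext x
    simp only [lastOneEvent, holeEvent, mem_ofPred_eq, Nat.cast_zero]
    grind
  rw [Finset.sum_range_succ']
  simp only [mul_zero, pow_zero, sub_self, zero_mul, add_zero]
  rw [hz, add_comm] at hsum
  conv_rhs => rw [← hsum]
  rw [add_right_inj, Finset.mul_sum]
  refine Finset.sum_congr rfl fun j _ => ?_
  have h1 := real_lastOneEvent_mul hμ.isStationaryLaw hμ.isRenewal (n := n) (j := j + 1) (by lia)
  have h2 := hμ.step {0} ((j + 1 : ℕ) : ℤ) 0 (by simp) (by simp) (by lia)
  rw [Finset.pair_comm, h2, hμ.single, h0, sub_zero, Int.toNat_natCast] at h1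
  apply mul_right_cancel₀ hκ
  rw [h1]
  ring

/-- The hole probabilities satisfy a linear recurrence of order two, whose characteristic polynomial
`z² - (1 + α² - κ(1 - α²)) z + α²` comes from the generating function of the renewal sequence. -/
lemma GeomCorr.hole_recurrence {μ : Measure (ℤ → Bool)} {κ α : ℝ} (hμ : GeomCorr μ κ α)
    (hκ : κ ≠ 0) (n : ℕ) :
    μ.real (holeEvent (n + 2)) = (1 + α ^ 2 - κ * (1 - α ^ 2)) * μ.real (holeEvent (n + 1)) -
      α ^ 2 * μ.real (holeEvent n) := by
  set h : ℕ → ℝ := fun n => μ.real (holeEvent n) with hh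
  let A : ℕ → ℝ := fun n => ∑ j ∈ Finset.range (n + 1), h (n - j)
  let B : ℕ → ℝ := fun n => ∑ j ∈ Finset.range (n + 1), α ^ (2 * j) * h (n - j)
  have hA : ∀ n, A (n + 1) = A n + h (n + 1) := by
    intro n
    simp only [A]
    rw [Finset.sum_range_succ']
    simp
  have hB : ∀ n, B (n + 1) = α ^ 2 * B n + h (n + 1) := by
    intro n
    simp only [B]
    rw [Finset.sum_range_succ', Finset.mul_sum]
    simp only [mul_zero, pow_zero, one_mul, Nat.sub_zero, add_left_inj, Nat.add_sub_add_right]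
    refine Finset.sum_congr rfl fun j _ => ?_
    ring
  have hR : ∀ n, h n + κ * (A n - B n) = κ := by
    intro n
    have := hμ.renewal_equation hκ n
    simp only [A, B, ← Finset.sum_sub_distrib, ← one_sub_mul]
    exact this
  have r0 := hR n
  have r1 := hR (n + 1)
  have r2 := hR (n + 2)
  have a1 := hA (n + 1)
  have b1 := hB (n + 1)
  rw [a1, b1] at r2
  rw [hA, hB] at r1
  rw [hB] at r2
  change h (n + 2) = _ * h (n + 1) - _ * h n
  rw [hA] at r2
  linear_combination r2 - r1 - α ^ 2 * (r1 - r0)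

lemma GeomCorr.real_holeEvent_zero {μ : Measure (ℤ → Bool)} {κ α : ℝ} (hμ : GeomCorr μ κ α) :
    μ.real (holeEvent 0) = κ := by
  rw [← hμ.single 0, onesOn_singleton]
  congr 1
  ext x
  simp only [holeEvent, mem_ofPred_eq]
  grind

lemma GeomCorr.real_holeEvent_one {μ : Measure (ℤ → Bool)} {κ α : ℝ} (hμ : GeomCorr μ κ α)
    (hκ : κ ≠ 0) : μ.real (holeEvent 1) = κ * (1 - κ * (1 - α ^ 2)) := by
  have h := hμ.renewal_equation hκ 1
  simp only [Finset.sum_range_succ, Finset.sum_range_zero, Nat.sub_self,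
    hμ.real_holeEvent_zero] at h
  simp only [mul_zero, pow_zero, sub_self, zero_mul, zero_add, mul_one] at h
  linear_combination h

/-- The law of the first return time when the density is the extreme value `(1 - α) / (1 + α)`, for
which the characteristic polynomial of the hole recurrence is `(z - α)²`. -/
lemma GeomCorr.cond_firstReturn {μ : Measure (ℤ → Bool)} {α : ℝ} (h0 : 0 ≤ α) (h1 : α < 1)
    (hμ : GeomCorr μ ((1 - α) / (1 + α)) α) (m : ℕ) (hm : 1 ≤ m) :
    μ[{x | IsLeast {k : ℕ | 1 ≤ k ∧ x (k : ℤ) = true} m} | {x | x 0 = true}] =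
      ENNReal.ofReal ((1 - α) ^ 2 * m * α ^ (m - 1)) := by
  have := hμ.prob
  obtain ⟨m, rfl⟩ : ∃ n, m = n + 1 := ⟨m - 1, by lia⟩
  set κ := (1 - α) / (1 + α) with hκ
  have hα : 0 < 1 + α := by linarith
  have hκ0 : 0 < κ := div_pos (by linarith) hα
  have hκα : κ * (1 + α) = 1 - α := by rw [hκ]; field_simp
  have hole : ∀ n : ℕ, μ.real (holeEvent n) = κ * ((1 + (1 - α) * n) * α ^ n) ∧
      μ.real (holeEvent (n + 1)) = κ * ((1 + (1 - α) * (n + 1)) * α ^ (n + 1)) := by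
    intro n
    induction n with
    | zero =>
      refine ⟨by simp [hμ.real_holeEvent_zero], ?_⟩
      rw [zero_add, hμ.real_holeEvent_one hκ0.ne']
      simp only [Nat.cast_zero]
      linear_combination (-κ * (1 - α)) * hκα
    | succ n ih =>
      refine ⟨by simpa using ih.2, ?_⟩
      rw [hμ.hole_recurrence hκ0.ne', ih.1, ih.2]
      push_cast
      linear_combination (-(1 - α) * (κ * ((1 + (1 - α) * (n + 1)) * α ^ (n + 1)))) * hκα
  have hset : {x : ℤ → Bool | x 0 = true} ∩
      {x | IsLeast {k : ℕ | 1 ≤ k ∧ x (k : ℤ) = true} (m + 1)} =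
      holeEvent m \ holeEvent (m + 1) := by
    ext x
    simp only [mem_inter_iff, mem_ofPred_eq, IsLeast, lowerBounds, holeEvent, Set.mem_sdiff]
    constructor
    · rintro ⟨hx, ⟨-, hm⟩, hl⟩
      refine ⟨⟨hx, fun k h1 h2 => ?_⟩, fun h => ?_⟩
      · by_contra h
        have := hl ⟨h1, by simpa using h⟩
        lia
      · have := h.2 (m + 1) (by lia) le_rfl
        rw [hm] at this
        exact absurd this (by simp)
    · rintro ⟨⟨hx, hz⟩, hn⟩
      refine ⟨hx, ⟨by lia, ?_⟩, fun k hk => ?_⟩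
      · by_contra h
        refine hn ⟨hx, fun k h1 h2 => ?_⟩
        rcases h2.lt_or_eq with h2 | rfl
        · exact hz k h1 (by lia)
        · simpa using h
      · by_contra h
        have := hz k hk.1 (by lia)
        rw [hk.2] at this
        exact absurd this (by simp)
  have hsub : holeEvent (m + 1) ⊆ holeEvent m :=
    fun x hx => ⟨hx.1, fun k h1 h2 => hx.2 k h1 (by lia)⟩
  rw [← ofReal_measureReal, measureReal_def, cond_apply (measurableSet_apply_eq 0 true), hset,
    ENNReal.toReal_mul, ENNReal.toReal_inv, ← measureReal_def, ← measureReal_def,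
    measureReal_sdiff hsub (measurableSet_holeEvent _), (hole m).1, (hole m).2, ← onesOn_singleton,
    hμ.single]
  congr 1
  rw [Nat.add_sub_cancel]
  field_simp
  push_cast
  ring

/-! ### The symbol as a Poisson kernel -/

lemma rungWeight_toReal {α : ℝ} (h0 : 0 < α) :
    (rungWeight α).toReal = (1 - α) ^ 2 / (2 * α) := by
  rw [rungWeight, if_neg h0.ne', ENNReal.toReal_ofReal (by positivity)]

lemma one_add_sq_sub_cos_pos {α : ℝ} (h0 : 0 ≤ α) (h1 : α < 1) (t : ℝ) :
    0 < 1 + α ^ 2 - 2 * α * Real.cos t := by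
  nlinarith [mul_nonneg h0 (sub_nonneg.mpr (Real.cos_le_one t)), sq_pos_of_pos (sub_pos.mpr h1)]

lemma ladderSymbol_eq {α : ℝ} (h0 : 0 ≤ α) (h1 : α < 1) (x : ℝ) :
    ladderSymbol (rungWeight α) x =
      (1 - α) ^ 2 / (1 + α ^ 2 - 2 * α * Real.cos (2 * Real.pi * x)) := by
  rcases h0.eq_or_lt with rfl | h0
  · simp [ladderSymbol, rungWeight]
  · have hpos := one_add_sq_sub_cos_pos h0.le h1 (2 * Real.pi * x)
    rw [ladderSymbol, if_neg (by simp [rungWeight, h0.ne']), rungWeight_toReal h0]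
    have : (1 - α) ^ 2 / (2 * α) + 1 - Real.cos (2 * Real.pi * x) =
        (1 + α ^ 2 - 2 * α * Real.cos (2 * Real.pi * x)) / (2 * α) := by
      field_simp
      ring
    rw [this, div_div_div_cancel_right₀ (by positivity)]

lemma ladderSymbol_mem_Icc {α : ℝ} (h0 : 0 ≤ α) (h1 : α < 1) (x : ℝ) :
    ladderSymbol (rungWeight α) x ∈ Icc (0 : ℝ) 1 := by
  rw [ladderSymbol_eq h0 h1]
  have hpos := one_add_sq_sub_cos_pos h0 h1 (2 * Real.pi * x)
  refine ⟨by positivity, (div_le_one hpos).mpr ?_⟩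
  nlinarith [mul_nonneg h0 (sub_nonneg.mpr (Real.cos_le_one (2 * Real.pi * x)))]

lemma measurable_ladderSymbol (c : ℝ≥0∞) : Measurable (ladderSymbol c) := by
  unfold ladderSymbol
  by_cases h : c = ∞
  · simp [h]
  · simp only [h, if_false]
    fun_prop

/-- The Fourier series of the Poisson kernel. -/
lemma hasSum_poisson {α : ℝ} (h0 : 0 ≤ α) (h1 : α < 1) (z : ℂ) (hz : ‖z‖ = 1) :
    HasSum (fun n : ℤ => (α : ℂ) ^ n.natAbs * z ^ n)
      ((1 - α ^ 2) / (1 + α ^ 2 - α * (z + z⁻¹))) := by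
  have hz0 : z ≠ 0 := by rintro rfl; simp at hz
  have ha : ‖(α : ℂ)‖ = α := by simp [abs_of_nonneg h0]
  have n1 : ‖(α : ℂ) * z‖ < 1 := by rw [norm_mul, ha, hz, mul_one]; exact h1
  have n2 : ‖(α : ℂ) * z⁻¹‖ < 1 := by rw [norm_mul, ha, norm_inv, hz, inv_one, mul_one]; exact h1
  have s1 := hasSum_geometric_of_norm_lt_one n1
  have s2 := (hasSum_geometric_of_norm_lt_one n2).mul_left ((α : ℂ) * z⁻¹)
  have hne : ∀ w : ℂ, ‖w‖ < 1 → 1 - w ≠ 0 := by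
    intro w hw h
    rw [sub_eq_zero] at h
    rw [← h] at hw
    simp at hw
  have a1 := hne _ n1
  have a2 := hne _ n2
  have e : (1 + α ^ 2 - α * (z + z⁻¹) : ℂ) = (1 - α * z) * (1 - α * z⁻¹) := by
    field_simp
    ring
  have e' : ((1 - α ^ 2) / (1 + α ^ 2 - α * (z + z⁻¹)) : ℂ) =
      (1 - α * z)⁻¹ + α * z⁻¹ * (1 - α * z⁻¹)⁻¹ := by
    rw [e, div_eq_iff (mul_ne_zero a1 a2), add_mul, ← mul_assoc, inv_mul_cancel₀ a1,
      mul_comm (1 - α * z : ℂ), ← mul_assoc, mul_assoc (α * z⁻¹ : ℂ), inv_mul_cancel₀ a2]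
    field_simp
    ring
  rw [e']
  refine HasSum.of_nat_of_neg_add_one (f := fun n : ℤ => (α : ℂ) ^ n.natAbs * z ^ n) ?_ ?_
  · have : (fun n : ℕ => (α : ℂ) ^ (n : ℤ).natAbs * z ^ (n : ℤ)) = fun n => (α * z : ℂ) ^ n := by
      funext n
      simp [mul_pow]
    rw [this]
    exact s1
  · have : (fun n : ℕ => (α : ℂ) ^ (-((n : ℤ) + 1)).natAbs * z ^ (-((n : ℤ) + 1))) =
        fun n => (α * z⁻¹ : ℂ) * (α * z⁻¹ : ℂ) ^ n := by
      funext n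
      have h : (-((n : ℤ) + 1)).natAbs = n + 1 := by lia
      rw [h, zpow_neg, ← Nat.cast_succ, zpow_natCast, ← pow_succ', mul_pow, inv_pow]
    rw [this]
    exact s2

lemma integral_exp_two_pi (m : ℤ) :
    ∫ x in (0 : ℝ)..1, Complex.exp (2 * Real.pi * Complex.I * m * x) = if m = 0 then 1 else 0 := by
  split_ifs with h
  · simp [h]
  · have hc : (2 * Real.pi * Complex.I * m : ℂ) ≠ 0 := by
      simp [h, Real.pi_ne_zero]
    rw [integral_exp_mul_complex hc]
    have : Complex.exp (2 * Real.pi * Complex.I * m) = 1 := by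
      rw [mul_comm]
      exact Complex.exp_int_mul_two_pi_mul_I m
    simp [this]

lemma fourierHat_ladderSymbol {α : ℝ} (h0 : 0 ≤ α) (h1 : α < 1) (k : ℤ) :
    fourierHat (ladderSymbol (rungWeight α)) k =
      (((1 - α) / (1 + α) * α ^ k.natAbs : ℝ) : ℂ) := by
  have hα : (1 + α : ℂ) ≠ 0 := by
    exact_mod_cast (show (1 + α : ℝ) ≠ 0 by linarith)
  -- the integrand, expanded into its Fourier series
  let F : ℤ → ℝ → ℂ := fun n x =>
    (1 - α) / (1 + α) * (α : ℂ) ^ n.natAbs * Complex.exp (2 * Real.pi * Complex.I * (n - k : ℤ) * x)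
  have hsum : ∀ x : ℝ, HasSum (fun n => F n x)
      ((ladderSymbol (rungWeight α) x : ℂ) * Complex.exp (-2 * Real.pi * Complex.I * k * x)) := by
    intro x
    set z := Complex.exp (2 * Real.pi * x * Complex.I) with hz
    have hz1 : ‖z‖ = 1 := by
      have := Complex.norm_exp_ofReal_mul_I (2 * Real.pi * x)
      push_cast at this
      exact this
    have h := ((hasSum_poisson h0 h1 z hz1).mul_left ((1 - α) / (1 + α) : ℂ)).mul_right
      (Complex.exp (-2 * Real.pi * Complex.I * k * x))
    have e1 : (fun n => F n x) = fun n : ℤ => (1 - α) / (1 + α) * ((α : ℂ) ^ n.natAbs * z ^ n) *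
        Complex.exp (-2 * Real.pi * Complex.I * k * x) := by
      funext n
      simp only [F]
      have : Complex.exp (2 * Real.pi * Complex.I * (n - k : ℤ) * x) =
          z ^ n * Complex.exp (-2 * Real.pi * Complex.I * k * x) := by
        rw [hz, ← Complex.exp_int_mul, ← Complex.exp_add]
        congr 1
        push_cast
        ring
      rw [this]
      ring
    have e2 : (ladderSymbol (rungWeight α) x : ℂ) =
        (1 - α) / (1 + α) * ((1 - α ^ 2) / (1 + α ^ 2 - α * (z + z⁻¹))) := by
      have hcos : z + z⁻¹ = 2 * Complex.cos (2 * Real.pi * x) := by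
        rw [Complex.two_cos, hz, ← Complex.exp_neg, neg_mul]
      rw [ladderSymbol_eq h0 h1, hcos]
      have hpos := one_add_sq_sub_cos_pos h0 h1 (2 * Real.pi * x)
      have hne : (1 + α ^ 2 - 2 * α * Complex.cos (2 * Real.pi * x) : ℂ) ≠ 0 := by
        exact_mod_cast hpos.ne'
      have hne' : (1 + α ^ 2 - α * (2 * Complex.cos (2 * Real.pi * x)) : ℂ) =
          1 + α ^ 2 - 2 * α * Complex.cos (2 * Real.pi * x) := by
        ring
      rw [hne']
      push_cast
      rw [← mul_div_assoc, div_left_inj' hne]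
      field_simp
      ring
    rw [e1, e2]
    exact h
  have hnorm : Summable fun n : ℤ => α ^ n.natAbs := by
    have := (hasSum_poisson h0 h1 1 (by simp)).summable.norm
    simpa [abs_of_nonneg h0] using this
  have hint := intervalIntegral.hasSum_integral_of_dominated_convergence
    (μ := volume) (a := 0) (b := 1) (F := F)
    (f := fun x : ℝ => (ladderSymbol (rungWeight α) x : ℂ) *
      Complex.exp (-2 * Real.pi * Complex.I * k * x))
    (fun n _ => ‖((1 - α) / (1 + α) : ℂ)‖ * α ^ n.natAbs)
    (fun n => by
      apply Continuous.aestronglyMeasurable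
      simp only [F]
      fun_prop)
    (fun n => Eventually.of_forall fun x _ => by
      have := Complex.norm_exp_ofReal_mul_I (2 * Real.pi * (n - k : ℤ) * x)
      have e : (2 * Real.pi * Complex.I * (n - k : ℤ) * x : ℂ) =
        ((2 * Real.pi * (n - k : ℤ) * x : ℝ) : ℂ) * Complex.I := by
        push_cast; ring
      simp only [F]
      rw [norm_mul, norm_mul, e, this, norm_pow, Complex.norm_real, Real.norm_of_nonneg h0,
        mul_one])
    (Eventually.of_forall fun x _ => hnorm.mul_left _)
    (by simp)
    (Eventually.of_forall fun x _ => hsum x)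
  have hF : ∀ n, ∫ x in (0 : ℝ)..1, F n x =
      if n = k then ((1 - α) / (1 + α) * (α : ℂ) ^ k.natAbs) else 0 := by
    intro n
    simp only [F]
    rw [intervalIntegral.integral_const_mul, integral_exp_two_pi]
    by_cases h : n = k
    · simp [h]
    · simp [h, sub_eq_zero]
  simp only [hF] at hint
  rw [fourierHat, hint.unique (hasSum_ite_eq k _)]
  push_cast
  rfl

lemma isFourierTransform_ladderSymbol {α : ℝ} (h0 : 0 ≤ α) (h1 : α < 1) (p : unitInterval) :
    IsFourierTransform (fun x => (p : ℝ) * ladderSymbol (rungWeight α) x)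
      (((p : ℝ) : ℂ) • ladderKernel α) := by
  refine ⟨(measurable_ladderSymbol _).const_mul _, fun x _ => ?_, fun k l => ?_⟩
  · have := ladderSymbol_mem_Icc h0 h1 x
    exact ⟨mul_nonneg p.2.1 this.1, mul_le_one₀ p.2.2 this.1 this.2⟩
  · have h : fourierHat (fun x => (p : ℝ) * ladderSymbol (rungWeight α) x) (l - k) =
        ((p : ℝ) : ℂ) * fourierHat (ladderSymbol (rungWeight α)) (l - k) := by
      rw [fourierHat, fourierHat, ← intervalIntegral.integral_const_mul]
      congr 1
      funext x
      push_cast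
      ring
    rw [h, fourierHat_ladderSymbol h0 h1]
    rfl

/-! ### Determinantal renewal processes -/

lemma det_submatrix_image {n : ℕ} {R : Type*} [CommRing R] (A : Matrix ℤ ℤ R) (f : Fin n → ℤ)
    (hf : Function.Injective f) :
    (A.submatrix (fun s : (Finset.univ.image f : Finset ℤ) => (s : ℤ))
      (fun s : (Finset.univ.image f : Finset ℤ) => (s : ℤ))).det = (A.submatrix f f).det := by
  let e : Fin n ≃ (Finset.univ.image f : Finset ℤ) :=
    Equiv.ofBijective (fun i => ⟨f i, Finset.mem_image_of_mem f (Finset.mem_univ i)⟩)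
      ⟨fun i j h => hf (congrArg Subtype.val h), fun ⟨s, hs⟩ => by
        obtain ⟨i, -, rfl⟩ := Finset.mem_image.mp hs
        exact ⟨i, rfl⟩⟩
  rw [← Matrix.det_submatrix_equiv_self e, Matrix.submatrix_submatrix]
  rfl

/-- A nonnegative solution of `h (n + 2) = t h (n + 1) - α² h n` cannot exist if the characteristic
polynomial has no real root on the right, that is if `t < 2 α`: the ratios `h (n + 1) / h n` would
decrease by at least `2 α - t` in each step. -/
lemma two_mul_le_of_recurrence {h : ℕ → ℝ} {t α : ℝ} (hα : 0 < α) (hnn : ∀ n, 0 ≤ h n)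
    (h0 : 0 < h 0) (hrec : ∀ n, h (n + 2) = t * h (n + 1) - α ^ 2 * h n) : 2 * α ≤ t := by
  by_contra! ht
  have hpos : ∀ n, 0 < h n := by
    intro n
    induction n with
    | zero => exact h0
    | succ n ih =>
      refine lt_of_le_of_ne (hnn _) fun h1 => ?_
      have h2 := hrec n
      rw [← h1] at h2
      nlinarith [hnn (n + 2), mul_pos (pow_pos hα 2) ih]
  have hle : ∀ n : ℕ, h (n + 1) ≤ (h 1 / h 0 - n * (2 * α - t)) * h n := by
    intro n
    induction n with
    | zero => simp [div_mul_cancel₀ _ h0.ne']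
    | succ n ih =>
      have hn := hpos n
      have hn1 := hpos (n + 1)
      rw [hrec]
      push_cast
      set r := h 1 / h 0 - n * (2 * α - t)
      -- multiply by `h n` and use `(h (n + 1) - α h n)² ≥ 0`
      have : (t * h (n + 1) - α ^ 2 * h n) * h n ≤
          ((h 1 / h 0 - (n + 1) * (2 * α - t)) * h (n + 1)) * h n := by
        have e : h 1 / h 0 - (n + 1) * (2 * α - t) = r - (2 * α - t) := by ring
        rw [e]
        nlinarith [sq_nonneg (h (n + 1) - α * h n), mul_le_mul_of_nonneg_left ih hn1.le]
      exact le_of_mul_le_mul_right this hn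
  obtain ⟨n, hn⟩ := exists_nat_gt (h 1 / h 0 / (2 * α - t))
  rw [div_lt_iff₀ (by linarith)] at hn
  have := hle n
  nlinarith [hpos (n + 1), hpos n]

/-- The density of a process with geometric correlations is at most `(1 - α) / (1 + α)`, since its
hole probabilities are nonnegative. -/
lemma GeomCorr.density_le {μ : Measure (ℤ → Bool)} {κ α : ℝ} (hμ : GeomCorr μ κ α) (h0 : 0 ≤ α)
    (h1 : α < 1) (hκ : 0 < κ) : κ * (1 + α) ≤ 1 - α := by
  have := hμ.prob
  rcases h0.eq_or_lt with rfl | h0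
  · have : κ ≤ 1 := by rw [← hμ.single 0]; exact measureReal_le_one
    linarith
  · have := two_mul_le_of_recurrence h0 (fun n => measureReal_nonneg)
      (by rw [hμ.real_holeEvent_zero]; exact hκ) (fun n => hμ.hole_recurrence hκ.ne' n)
    nlinarith

section classification

variable {ν : Measure (ℤ → Bool)} {A : Matrix ℤ ℤ ℂ}

lemma IsStationaryLaw.real_onesOn_image (hs : IsStationaryLaw ν) (j : ℤ) (S : Finset ℤ) :
    ν.real (onesOn (S.image (· + j))) = ν.real (onesOn S) := by
  rw [← preimage_shift_onesOn]
  exact hs.real_shift j (measurableSet_onesOn S)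

lemma IsStationaryLaw.real_onesOn_singleton (hs : IsStationaryLaw ν) (a : ℤ) :
    ν.real (onesOn {a}) = ν.real (onesOn {0}) := by
  simpa using hs.real_onesOn_image a {0}

lemma IsStationaryLaw.real_onesOn_pair (hs : IsStationaryLaw ν) (a d : ℤ) :
    ν.real (onesOn {a, a + d}) = ν.real (onesOn {0, d}) := by
  rw [← hs.real_onesOn_image a {0, d}, Finset.image_insert, Finset.image_singleton, zero_add,
    add_comm]

lemma IsRenewal.real_onesOn_insert (hr : IsRenewal ν) (hs : IsStationaryLaw ν) (S : Finset ℤ)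
    (a b : ℤ) (hb : b ∈ S) (hS : ∀ s ∈ S, s ≤ b) (hab : b < a) :
    ν.real (onesOn (insert a S)) * ν.real (onesOn {b}) =
      ν.real (onesOn {b, a}) * ν.real (onesOn S) := by
  have h := hr.real_mul hs b (measurableSet_onesOn (S.erase b)) (measurableSet_onesOn {a})
    (fun x y hxy hx s hs => by
      have h1 := Finset.mem_erase.mp hs
      rw [← hxy s (lt_of_le_of_ne (hS s h1.2) h1.1)]
      exact hx s hs)
    (fun x y hxy hx s hs => by
      rw [← hxy s (by rw [Finset.mem_singleton.mp hs]; exact hab)]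
      exact hx s hs)
  rw [← onesOn_singleton b, inter_comm (onesOn (S.erase b)), onesOn_singleton b,
    ← onesOn_insert, Finset.insert_erase hb, inter_comm (onesOn {a}) {x | x b = true},
    ← onesOn_insert, ← onesOn_singleton b, onesOn_singleton a, ← onesOn_insert] at h
  exact h

lemma IsHermitianDeterminantal.apply_self (hA : IsHermitianDeterminantal ν A) (a : ℤ) :
    A a a = (ν.real (onesOn {a}) : ℂ) := by
  have h := hA.2 (Finset.univ.image ![a])
  rw [det_submatrix_image _ _ (by intro i j _; exact Subsingleton.elim i j),
    Matrix.det_fin_one] at h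
  simpa [onesOn] using h.symm

lemma IsHermitianDeterminantal.real_pair (hA : IsHermitianDeterminantal ν A) {i j : ℤ}
    (hij : i ≠ j) :
    ν.real (onesOn {i, j}) =
      ν.real (onesOn {i}) * ν.real (onesOn {j}) - Complex.normSq (A i j) := by
  have h := hA.2 (Finset.univ.image ![i, j])
  rw [det_submatrix_image _ _ (by
    intro k l; fin_cases k <;> fin_cases l <;> simp [hij, hij.symm]), Matrix.det_fin_two] at h
  have e : (Finset.univ.image ![i, j] : Finset ℤ) = {i, j} := by
    ext x; simp [Fin.exists_fin_two, eq_comm]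
  rw [e] at h
  simp only [Matrix.submatrix_apply, Matrix.cons_val_zero, Matrix.cons_val_one] at h
  rw [hA.apply_self, hA.apply_self, ← hA.1.apply j i, Complex.star_def, Complex.mul_conj] at h
  exact_mod_cast h

lemma IsHermitianDeterminantal.real_triple (hA : IsHermitianDeterminantal ν A) {ρ : ℝ}
    (hρ : ∀ a, ν.real (onesOn {a}) = ρ) {i j k : ℤ} (hij : i ≠ j) (hjk : j ≠ k) (hik : i ≠ k) :
    ν.real (onesOn {i, j, k}) = ρ ^ 3 - ρ * (Complex.normSq (A i j) + Complex.normSq (A j k) +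
      Complex.normSq (A i k)) + 2 * (A i j * A j k * star (A i k)).re := by
  have h := hA.2 (Finset.univ.image ![i, j, k])
  rw [det_submatrix_image _ _ (by
    intro k l; fin_cases k <;> fin_cases l <;> simp [hij, hij.symm, hjk, hjk.symm, hik, hik.symm]),
    Matrix.det_fin_three] at h
  have e : (Finset.univ.image ![i, j, k] : Finset ℤ) = {i, j, k} := by
    ext x; simp [Fin.exists_fin_succ, eq_comm]
  rw [e] at h
  simp only [Matrix.submatrix_apply, Matrix.cons_val_zero, Matrix.cons_val_one,
    Matrix.cons_val] at h
  rw [hA.apply_self, hA.apply_self, hA.apply_self, hρ, hρ, hρ, ← hA.1.apply j i, ← hA.1.apply k j,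
    ← hA.1.apply k i] at h
  have h2 := congrArg Complex.re h
  rw [Complex.ofReal_re] at h2
  change ν.real (onesOn {i, j, k}) = _ at h2
  rw [h2]
  simp [Complex.normSq_apply]
  ring

/-- Comparing the three-point determinant with the renewal property yields
`2 ρ Re (A i j * A j k * A k i) = ρ² |A i k|² + |A i j|² |A j k|²`; by the inequality of arithmetic
and geometric means, the squared moduli of the entries are then multiplicative. -/
lemma normSq_mul_normSq (hA : IsHermitianDeterminantal ν A) (hs : IsStationaryLaw ν)
    (hr : IsRenewal ν) {ρ : ℝ} (hρ : ∀ a, ν.real (onesOn {a}) = ρ) {i j k : ℤ}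
    (hij : i < j) (hjk : j < k) :
    ρ ^ 2 * Complex.normSq (A i k) = Complex.normSq (A i j) * Complex.normSq (A j k) := by
  have h1 := hr.real_onesOn_insert hs {i, j} k j (by simp) (by simp [hij.le]) hjk
  have e : (insert k {i, j} : Finset ℤ) = {i, j, k} := by
    ext x; simp only [Finset.mem_insert, Finset.mem_singleton]; tauto
  rw [e, hA.real_triple hρ hij.ne hjk.ne (hij.trans hjk).ne, hA.real_pair hij.ne,
    hA.real_pair hjk.ne, hρ, hρ, hρ] at h1
  set x := Complex.normSq (A i j) with hx
  set y := Complex.normSq (A j k) with hy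
  set z := Complex.normSq (A i k) with hz
  set w := A i j * A j k * star (A i k) with hw
  have hR : w.re ^ 2 ≤ x * y * z := by
    have : Complex.normSq w = x * y * z := by
      rw [hw, hx, hy, hz, Complex.normSq_mul, Complex.normSq_mul, Complex.star_def,
        Complex.normSq_conj]
    rw [← this, Complex.normSq_apply]
    nlinarith [sq_nonneg w.im]
  have h2 : 2 * w.re * ρ = ρ ^ 2 * z + x * y := by linear_combination h1
  have h3 : (ρ ^ 2 * z - x * y) ^ 2 ≤ 0 := by
    have : (ρ ^ 2 * z + x * y) ^ 2 ≤ 4 * ρ ^ 2 * (x * y * z) := by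
      rw [← h2]
      nlinarith [mul_le_mul_of_nonneg_left hR (sq_nonneg ρ)]
    linarith
  have h4 : ρ ^ 2 * z - x * y = 0 := by
    have := le_antisymm h3 (sq_nonneg _)
    exact pow_eq_zero_iff (two_ne_zero) |>.mp this
  linarith

/-- In a stationary law with positive density, two sites are jointly occupied with positive
probability, since otherwise the occupation events would be disjoint. -/
lemma IsStationaryLaw.exists_pair_ne_zero [IsProbabilityMeasure ν] (hs : IsStationaryLaw ν)
    (h0 : 0 < ν.real (onesOn {0})) : ∃ d : ℕ, 0 < d ∧ ν.real (onesOn {0, (d : ℤ)}) ≠ 0 := by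
  by_contra! H
  have hdis : ∀ i j : ℕ, i < j → ν (onesOn {(i : ℤ)} ∩ onesOn {(j : ℤ)}) = 0 := by
    intro i j hij
    have h1 := hs.real_onesOn_pair i ((j - i : ℕ) : ℤ)
    rw [H (j - i) (by lia)] at h1
    have e : (i : ℤ) + ((j - i : ℕ) : ℤ) = j := by lia
    rw [e, measureReal_eq_zero_iff, onesOn_insert, ← onesOn_singleton] at h1
    exact h1
  have hsum : ∀ N : ℕ, N * ν.real (onesOn {0}) ≤ 1 := by
    intro N
    have h1 : ν.real (⋃ i ∈ Finset.range N, onesOn {(i : ℤ)}) =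
        ∑ i ∈ Finset.range N, ν.real (onesOn {(i : ℤ)}) := by
      rw [measureReal_def, measure_biUnion_finset₀, ENNReal.toReal_sum (by finiteness)]
      · rfl
      · intro i _ j _ hij
        rcases lt_or_gt_of_ne hij with h | h
        · exact hdis i j h
        · rw [Function.onFun, AEDisjoint, inter_comm]
          exact hdis j i h
      · exact fun i _ => (measurableSet_onesOn _).nullMeasurableSet
    simp only [hs.real_onesOn_singleton, Finset.sum_const, Finset.card_range, nsmul_eq_mul] at h1
    rw [← h1]
    exact measureReal_le_one
  obtain ⟨N, hN⟩ := exists_nat_gt (1 / ν.real (onesOn {0}))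
  rw [div_lt_iff₀ h0] at hN
  exact absurd (hsum N) (not_le.mpr hN)

/-- A stationary determinantal renewal process has geometric correlations. -/
theorem exists_geomCorr [IsProbabilityMeasure ν] (hs : IsStationaryLaw ν)
    (hA : IsHermitianDeterminantal ν A) (hr : IsRenewal ν) :
    ∃ α : ℝ, 0 ≤ α ∧ α < 1 ∧ ∃ p : unitInterval, GeomCorr ν (p * ((1 - α) / (1 + α))) α := by
  set ρ := ν.real (onesOn {0}) with hρdef
  have hρ : ∀ a, ν.real (onesOn {a}) = ρ := hs.real_onesOn_singleton
  rcases (show 0 ≤ ρ from measureReal_nonneg).eq_or_lt with h0 | h0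
  · refine ⟨0, le_rfl, one_pos, 0, inferInstance, fun a => by simp [hρ, h0.symm], ?_⟩
    intro S a b _ _ _
    have : ν.real (onesOn (insert a S)) ≤ ν.real (onesOn {a}) :=
      measureReal_mono (by rw [onesOn_insert, onesOn_singleton]; exact inter_subset_left)
    rw [hρ, ← h0] at this
    simp [le_antisymm this measureReal_nonneg]
  -- `a d` is the squared modulus of the entries at distance `d`, relative to the diagonal
  let a : ℕ → ℝ := fun d => 1 - ν.real (onesOn {0, (d : ℤ)}) / ρ ^ 2
  have hpair : ∀ (i : ℤ) (d : ℕ), ν.real (onesOn {i, i + d}) = ρ ^ 2 * (1 - a d) := by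
    intro i d
    rw [hs.real_onesOn_pair]
    simp only [a]
    field_simp
    ring
  have hnorm : ∀ (i : ℤ) (d : ℕ), 0 < d → Complex.normSq (A i (i + d)) = ρ ^ 2 * a d := by
    intro i d hd
    have h1 := hA.real_pair (i := i) (j := i + d) (by lia)
    rw [hpair, hρ, hρ] at h1
    linarith
  have hmul : ∀ d e : ℕ, 0 < d → 0 < e → a (d + e) = a d * a e := by
    intro d e hd he
    have h1 := normSq_mul_normSq hA hs hr hρ (i := 0) (j := 0 + (d : ℤ)) (k := 0 + (d : ℤ) + e)
      (by lia) (by lia)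
    rw [hnorm _ _ hd, hnorm _ _ he, add_assoc, ← Nat.cast_add, hnorm _ _ (by lia)] at h1
    have : ρ ^ 4 ≠ 0 := by positivity
    apply mul_left_cancel₀ this
    linear_combination h1
  have ha0 : ∀ d, 0 < d → 0 ≤ a d := by
    intro d hd
    have h1 := hnorm 0 d hd
    have h2 := Complex.normSq_nonneg (A 0 (0 + d))
    rw [h1] at h2
    exact nonneg_of_mul_nonneg_right h2 (by positivity)
  have ha1 : ∀ d, a d ≤ 1 := fun d => sub_le_self _ (by positivity)
  have hpow : ∀ d : ℕ, a (d + 1) = a 1 ^ (d + 1) := by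
    intro d
    induction d with
    | zero => simp
    | succ d ih => rw [hmul (d + 1) 1 (by lia) one_pos, ih, ← pow_succ]
  have hlt : a 1 < 1 := by
    refine lt_of_le_of_ne (ha1 1) fun h => ?_
    obtain ⟨d, hd, hne⟩ := hs.exists_pair_ne_zero h0
    obtain ⟨d, rfl⟩ : ∃ e, d = e + 1 := ⟨d - 1, by lia⟩
    apply hne
    have := hpair 0 (d + 1)
    rwa [hpow, h, one_pow, sub_self, mul_zero, zero_add] at this
  set α := √(a 1) with hα
  have hα0 : 0 ≤ α := Real.sqrt_nonneg _
  have hαsq : α ^ 2 = a 1 := Real.sq_sqrt (ha0 1 one_pos)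
  have hα1 : α < 1 := by
    rw [hα, Real.sqrt_lt' one_pos]
    simpa using hlt
  have hgeom : GeomCorr ν ρ α := by
    refine ⟨inferInstance, hρ, fun S x b hb hS hbx => ?_⟩
    have h1 := hr.real_onesOn_insert hs S x b hb hS hbx
    obtain ⟨d, hd⟩ : ∃ d : ℕ, x = b + (d + 1 : ℕ) := ⟨(x - b - 1).toNat, by lia⟩
    have h2 : (x - b).toNat = d + 1 := by lia
    have h3 := hpair b (d + 1)
    rw [hpow, ← hαsq, ← pow_mul, ← hd] at h3
    rw [hρ, h3] at h1
    rw [h2]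
    apply mul_right_cancel₀ h0.ne'
    rw [h1]
    ring
  have hle := hgeom.density_le hα0 hα1 h0
  have hpos : 0 < 1 - α := by linarith
  refine ⟨α, hα0, hα1, ⟨ρ * (1 + α) / (1 - α), by positivity, (div_le_one hpos).mpr hle⟩, ?_⟩
  have : ρ * (1 + α) / (1 - α) * ((1 - α) / (1 + α)) = ρ := by field_simp
  rw [this]
  exact hgeom

end classification

/-! ### Spanning trees via functions that are constant along edges -/

section spans

variable {V : Type*}

/-- The predicate `f` on vertices is constant along every edge of `t`. -/
def ConstAlong (f : V → Prop) (t : Finset (Sym2 V)) : Prop :=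
  ∀ u v, s(u, v) ∈ t → (f u ↔ f v)

/-- The edges in `t` connect all vertices of `W`: a predicate that is constant along the edges is
constant on `W`. -/
def Spans (W : Finset V) (t : Finset (Sym2 V)) : Prop :=
  ∀ f : V → Prop, ConstAlong f t → ∀ u ∈ W, ∀ v ∈ W, (f u ↔ f v)

/-- The edge set `t` is a spanning tree of `W`, expressed through connectedness and the number of
edges. -/
def TreeOn (W : Finset V) (t : Finset (Sym2 V)) : Prop := Spans W t ∧ t.card + 1 = W.card

lemma constAlong_insert [DecidableEq V] (f : V → Prop) (a b : V) (t : Finset (Sym2 V)) :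
    ConstAlong f (insert s(a, b) t) ↔ (f a ↔ f b) ∧ ConstAlong f t := by
  constructor
  · exact fun h => ⟨h a b (by simp), fun u v huv => h u v (by simp [huv])⟩
  · rintro ⟨h1, h2⟩ u v huv
    rw [Finset.mem_insert, Sym2.eq_iff] at huv
    rcases huv with (⟨rfl, rfl⟩ | ⟨rfl, rfl⟩) | h
    · exact h1
    · exact h1.symm
    · exact h2 u v h

lemma connected_induce_iff_spans {W : Finset V} (hW : W.Nonempty) {t : Finset (Sym2 V)}
    (ht : ∀ u v, s(u, v) ∈ t → u ∈ W ∧ v ∈ W ∧ u ≠ v) :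
    ((SimpleGraph.fromEdgeSet (t : Set (Sym2 V))).induce (W : Set V)).Connected ↔ Spans W t := by
  constructor
  · intro h f hf u hu v hv
    obtain ⟨p⟩ := h.preconnected ⟨u, hu⟩ ⟨v, hv⟩
    have key : ∀ x y : (W : Set V),
        ((SimpleGraph.fromEdgeSet (t : Set (Sym2 V))).induce (W : Set V)).Walk x y →
          (f x ↔ f y) := by
      intro x y p
      induction p with
      | nil => rfl
      | cons h _ ih =>
        refine Iff.trans ?_ ih
        simp only [SimpleGraph.comap_adj, SimpleGraph.fromEdgeSet_adj] at h
        exact hf _ _ h.1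
    exact key _ _ p
  · intro h
    obtain ⟨w, hw⟩ := hW
    have : Nonempty (W : Set V) := ⟨⟨w, hw⟩⟩
    refine ⟨fun ⟨u, hu⟩ ⟨v, hv⟩ => ?_⟩
    have h1 := h (fun v => ∃ hv : v ∈ (W : Set V),
      ((SimpleGraph.fromEdgeSet (t : Set (Sym2 V))).induce (W : Set V)).Reachable ⟨u, hu⟩ ⟨v, hv⟩)
      (by
        intro x y hxy
        obtain ⟨hx, hy, hne⟩ := ht x y hxy
        have hadj : ((SimpleGraph.fromEdgeSet (t : Set (Sym2 V))).induce (W : Set V)).Adj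
            ⟨x, hx⟩ ⟨y, hy⟩ := by
          simp only [SimpleGraph.comap_adj, SimpleGraph.fromEdgeSet_adj]
          exact ⟨hxy, hne⟩
        exact ⟨fun ⟨_, h⟩ => ⟨hy, h.trans hadj.reachable⟩,
          fun ⟨_, h⟩ => ⟨hx, h.trans hadj.symm.reachable⟩⟩) u hu v hv
    exact (h1.mp ⟨hu, SimpleGraph.Reachable.refl _⟩).2

lemma card_edgeSet_induce {W : Finset V} {t : Finset (Sym2 V)}
    (ht : ∀ u v, s(u, v) ∈ t → u ∈ W ∧ v ∈ W ∧ u ≠ v) :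
    Nat.card ((SimpleGraph.fromEdgeSet (t : Set (Sym2 V))).induce (W : Set V)).edgeSet =
      t.card := by
  have h : Sym2.map (fun x : (W : Set V) => (x : V)) ''
      ((SimpleGraph.fromEdgeSet (t : Set (Sym2 V))).induce (W : Set V)).edgeSet = t := by
    ext e
    induction e using Sym2.ind with | _ u v
    constructor
    · rintro ⟨e, he, h⟩
      induction e using Sym2.ind with | _ x y
      simp only [SimpleGraph.mem_edgeSet, SimpleGraph.comap_adj,
        SimpleGraph.fromEdgeSet_adj] at he
      rw [← h]
      exact he.1
    · intro h
      obtain ⟨hu, hv, hne⟩ := ht u v h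
      refine ⟨s(⟨u, hu⟩, ⟨v, hv⟩), ?_, rfl⟩
      simp only [SimpleGraph.mem_edgeSet, SimpleGraph.comap_adj, SimpleGraph.fromEdgeSet_adj]
      exact ⟨h, hne⟩
  have h2 := congrArg Set.ncard h
  rwa [Set.ncard_image_of_injective _ (Sym2.map.injective Subtype.val_injective),
    Set.ncard_coe_finset] at h2

lemma isTree_induce_iff_treeOn {W : Finset V} (hW : W.Nonempty) {t : Finset (Sym2 V)}
    (ht : ∀ u v, s(u, v) ∈ t → u ∈ W ∧ v ∈ W ∧ u ≠ v) :
    ((SimpleGraph.fromEdgeSet (t : Set (Sym2 V))).induce (W : Set V)).IsTree ↔ TreeOn W t := by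
  have : Finite (W : Set V) := W.finite_toSet
  rw [SimpleGraph.isTree_iff_connected_and_card, connected_induce_iff_spans hW ht,
    card_edgeSet_induce ht, TreeOn]
  simp

lemma Spans.card_le {W : Finset V} (hW : W.Nonempty) {t : Finset (Sym2 V)}
    (ht : ∀ u v, s(u, v) ∈ t → u ∈ W ∧ v ∈ W ∧ u ≠ v) (h : Spans W t) :
    W.card ≤ t.card + 1 := by
  have h1 := ((connected_induce_iff_spans hW ht).mpr h).card_vert_le_card_edgeSet_add_one
  rw [card_edgeSet_induce ht] at h1
  simpa using h1

/-! ### Attaching a new column to a ladder -/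

/-- The situation in which two new vertices `u₀, u₁` are attached to the vertices `v₀, v₁` of a
graph on `W` with edge set `t`. -/
structure NewColumn (W : Finset V) (t : Finset (Sym2 V)) (v₀ v₁ u₀ u₁ : V) : Prop where
  edges : ∀ u v, s(u, v) ∈ t → u ∈ W ∧ v ∈ W ∧ u ≠ v
  mem₀ : v₀ ∈ W
  mem₁ : v₁ ∈ W
  ne : v₀ ≠ v₁
  notMem₀ : u₀ ∉ W
  notMem₁ : u₁ ∉ W
  ne' : u₀ ≠ u₁

variable {W : Finset V} {t : Finset (Sym2 V)} {v₀ v₁ u₀ u₁ : V}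

namespace NewColumn

lemma notMem_of_notMem (h : NewColumn W t v₀ v₁ u₀ u₁) {u v : V} (hv : v ∉ W) :
    s(u, v) ∉ t := fun huv => hv (h.edges u v huv).2.1

lemma ne_left_right (h : NewColumn W t v₀ v₁ u₀ u₁) : s(v₀, u₀) ≠ s(v₁, u₁) := by
  have := h.ne
  have h2 : v₀ ≠ u₁ := fun e => h.notMem₁ (e ▸ h.mem₀)
  rw [Ne, Sym2.eq_iff]
  tauto

lemma ne_left_rung (h : NewColumn W t v₀ v₁ u₀ u₁) : s(v₀, u₀) ≠ s(u₀, u₁) := by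
  have := h.ne'
  have h2 : v₀ ≠ u₁ := fun e => h.notMem₁ (e ▸ h.mem₀)
  rw [Ne, Sym2.eq_iff]
  tauto

lemma ne_right_rung (h : NewColumn W t v₀ v₁ u₀ u₁) : s(v₁, u₁) ≠ s(u₀, u₁) := by
  have := h.ne'
  have h2 : v₁ ≠ u₀ := fun e => h.notMem₀ (e ▸ h.mem₁)
  rw [Ne, Sym2.eq_iff]
  tauto

lemma symm (h : NewColumn W t v₀ v₁ u₀ u₁) : NewColumn W t v₁ v₀ u₁ u₀ :=
  ⟨h.edges, h.mem₁, h.mem₀, h.ne.symm, h.notMem₁, h.notMem₀, h.ne'.symm⟩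

variable [DecidableEq V]

lemma exists_extend (h : NewColumn W t v₀ v₁ u₀ u₁) (f : V → Prop) (p q : Prop) :
    ∃ g : V → Prop, (∀ w ∈ W, g w ↔ f w) ∧ (g u₀ ↔ p) ∧ (g u₁ ↔ q) ∧
      (ConstAlong f t → ConstAlong g t) := by
  have h0 := h.notMem₀
  have h1 := h.notMem₁
  have hW : ∀ w ∈ W, (Function.update (Function.update f u₀ p) u₁ q) w ↔ f w := by
    intro w hw
    rw [Function.update_of_ne (by rintro rfl; exact h1 hw),
      Function.update_of_ne (by rintro rfl; exact h0 hw)]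
  refine ⟨Function.update (Function.update f u₀ p) u₁ q, hW, ?_, ?_, fun hf u v huv => ?_⟩
  · rw [Function.update_of_ne h.ne', Function.update_self]
  · rw [Function.update_self]
  · obtain ⟨hu, hv, -⟩ := h.edges u v huv
    rw [hW u hu, hW v hv]
    exact hf u v huv

lemma card_insert_insert (h : NewColumn W t v₀ v₁ u₀ u₁) :
    (insert u₀ (insert u₁ W)).card = W.card + 2 := by
  rw [Finset.card_insert_of_notMem, Finset.card_insert_of_notMem h.notMem₁]
  simp [h.ne', h.notMem₀]

/-- The new column is not attached. -/
lemma not_treeOn_rung (h : NewColumn W t v₀ v₁ u₀ u₁) :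
    ¬ TreeOn (insert u₀ (insert u₁ W)) (insert s(u₀, u₁) t) := by
  rintro ⟨hs, -⟩
  obtain ⟨g, hg, g0, g1, gt⟩ := h.exists_extend (fun _ => False) True True
  have := hs g (by
    rw [constAlong_insert, g0, g1]
    exact ⟨Iff.rfl, gt fun _ _ _ => Iff.rfl⟩) u₀ (by simp) v₀ (by simp [h.mem₀])
  rw [g0, hg _ h.mem₀] at this
  exact this.mp trivial

lemma not_treeOn_empty (h : NewColumn W t v₀ v₁ u₀ u₁) :
    ¬ TreeOn (insert u₀ (insert u₁ W)) t := by
  rintro ⟨hs, -⟩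
  obtain ⟨g, hg, g0, g1, gt⟩ := h.exists_extend (fun _ => False) True True
  have := hs g (gt fun _ _ _ => Iff.rfl) u₀ (by simp) v₀ (by simp [h.mem₀])
  rw [g0, hg _ h.mem₀] at this
  exact this.mp trivial

lemma not_treeOn_left (h : NewColumn W t v₀ v₁ u₀ u₁) :
    ¬ TreeOn (insert u₀ (insert u₁ W)) (insert s(v₀, u₀) t) := by
  rintro ⟨hs, -⟩
  obtain ⟨g, hg, g0, g1, gt⟩ := h.exists_extend (fun _ => False) False True
  have := hs g (by
    rw [constAlong_insert, g0, hg _ h.mem₀]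
    exact ⟨Iff.rfl, gt fun _ _ _ => Iff.rfl⟩) u₁ (by simp) v₀ (by simp [h.mem₀])
  rw [g1, hg _ h.mem₀] at this
  exact this.mp trivial

lemma not_treeOn_right (h : NewColumn W t v₀ v₁ u₀ u₁) :
    ¬ TreeOn (insert u₀ (insert u₁ W)) (insert s(v₁, u₁) t) := by
  rintro ⟨hs, -⟩
  obtain ⟨g, hg, g0, g1, gt⟩ := h.exists_extend (fun _ => False) True False
  have := hs g (by
    rw [constAlong_insert, g1, hg _ h.mem₁]
    exact ⟨Iff.rfl, gt fun _ _ _ => Iff.rfl⟩) u₀ (by simp) v₁ (by simp [h.mem₁])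
  rw [g0, hg _ h.mem₁] at this
  exact this.mp trivial

lemma treeOn_left_right (h : NewColumn W t v₀ v₁ u₀ u₁) :
    TreeOn (insert u₀ (insert u₁ W)) (insert s(v₀, u₀) (insert s(v₁, u₁) t)) ↔ TreeOn W t := by
  rw [TreeOn, TreeOn, h.card_insert_insert, Finset.card_insert_of_notMem,
    Finset.card_insert_of_notMem (h.notMem_of_notMem h.notMem₁)]
  swap
  · simp only [Finset.mem_insert, h.ne_left_right, false_or]
    exact h.notMem_of_notMem h.notMem₀
  refine and_congr ⟨fun hs f hf u hu v hv => ?_, fun hs f hf => ?_⟩ (by lia)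
  · obtain ⟨g, hg, g0, g1, gt⟩ := h.exists_extend f (f v₀) (f v₁)
    rw [← hg u hu, ← hg v hv]
    refine hs g ?_ u (by simp [hu]) v (by simp [hv])
    rw [constAlong_insert, constAlong_insert, g0, g1, hg _ h.mem₀, hg _ h.mem₁]
    exact ⟨Iff.rfl, Iff.rfl, gt hf⟩
  · rw [constAlong_insert, constAlong_insert] at hf
    obtain ⟨h1, h2, h3⟩ := hf
    have hc := hs f h3 v₀ h.mem₀
    have : ∀ u ∈ insert u₀ (insert u₁ W), (f v₀ ↔ f u) := by
      simp only [Finset.mem_insert]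
      rintro u (rfl | rfl | hu)
      exacts [h1, (hc _ h.mem₁).trans h2, hc u hu]
    exact fun u hu v hv => (this u hu).symm.trans (this v hv)

lemma treeOn_left_rung (h : NewColumn W t v₀ v₁ u₀ u₁) :
    TreeOn (insert u₀ (insert u₁ W)) (insert s(v₀, u₀) (insert s(u₀, u₁) t)) ↔ TreeOn W t := by
  rw [TreeOn, TreeOn, h.card_insert_insert, Finset.card_insert_of_notMem,
    Finset.card_insert_of_notMem (h.notMem_of_notMem h.notMem₁)]
  swap
  · simp only [Finset.mem_insert, h.ne_left_rung, false_or]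
    exact h.notMem_of_notMem h.notMem₀
  refine and_congr ⟨fun hs f hf u hu v hv => ?_, fun hs f hf => ?_⟩ (by lia)
  · obtain ⟨g, hg, g0, g1, gt⟩ := h.exists_extend f (f v₀) (f v₀)
    rw [← hg u hu, ← hg v hv]
    refine hs g ?_ u (by simp [hu]) v (by simp [hv])
    rw [constAlong_insert, constAlong_insert, g0, g1, hg _ h.mem₀]
    exact ⟨Iff.rfl, Iff.rfl, gt hf⟩
  · rw [constAlong_insert, constAlong_insert] at hf
    obtain ⟨h1, h2, h3⟩ := hf
    have hc := hs f h3 v₀ h.mem₀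
    have : ∀ u ∈ insert u₀ (insert u₁ W), (f v₀ ↔ f u) := by
      simp only [Finset.mem_insert]
      rintro u (rfl | rfl | hu)
      exacts [h1, h1.trans h2, hc u hu]
    exact fun u hu v hv => (this u hu).symm.trans (this v hv)

lemma treeOn_right_rung (h : NewColumn W t v₀ v₁ u₀ u₁) :
    TreeOn (insert u₀ (insert u₁ W)) (insert s(v₁, u₁) (insert s(u₀, u₁) t)) ↔ TreeOn W t := by
  rw [← h.symm.treeOn_left_rung, Finset.insert_comm u₀ u₁, Sym2.eq_swap (a := u₀)]

/-- With both rails and the rung, the new column acts as a path from `v₀` to `v₁`, which can be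
contracted to the rung between these vertices. -/
lemma treeOn_left_right_rung (h : NewColumn W t v₀ v₁ u₀ u₁) :
    TreeOn (insert u₀ (insert u₁ W))
        (insert s(v₀, u₀) (insert s(v₁, u₁) (insert s(u₀, u₁) t))) ↔
      s(v₀, v₁) ∉ t ∧ TreeOn W (insert s(v₀, v₁) t) := by
  have hspan : Spans (insert u₀ (insert u₁ W))
        (insert s(v₀, u₀) (insert s(v₁, u₁) (insert s(u₀, u₁) t))) ↔
      Spans W (insert s(v₀, v₁) t) := by
    refine ⟨fun hs f hf u hu v hv => ?_, fun hs f hf => ?_⟩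
    · obtain ⟨g, hg, g0, g1, gt⟩ := h.exists_extend f (f v₀) (f v₁)
      rw [constAlong_insert] at hf
      rw [← hg u hu, ← hg v hv]
      refine hs g ?_ u (by simp [hu]) v (by simp [hv])
      rw [constAlong_insert, constAlong_insert, constAlong_insert, g0, g1, hg _ h.mem₀,
        hg _ h.mem₁]
      exact ⟨Iff.rfl, Iff.rfl, hf.1, gt hf.2⟩
    · rw [constAlong_insert, constAlong_insert, constAlong_insert] at hf
      obtain ⟨h1, h2, h3, h4⟩ := hf
      have hc := hs f ((constAlong_insert f _ _ _).mpr ⟨(h1.trans h3).trans h2.symm, h4⟩) v₀ h.mem₀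
      have : ∀ u ∈ insert u₀ (insert u₁ W), (f v₀ ↔ f u) := by
        simp only [Finset.mem_insert]
        rintro u (rfl | rfl | hu)
        exacts [h1, h1.trans h3, hc u hu]
      exact fun u hu v hv => (this u hu).symm.trans (this v hv)
  have hcard : (insert s(v₀, u₀) (insert s(v₁, u₁) (insert s(u₀, u₁) t))).card = t.card + 3 := by
    rw [Finset.card_insert_of_notMem, Finset.card_insert_of_notMem,
      Finset.card_insert_of_notMem (h.notMem_of_notMem h.notMem₁)]
    · simp only [Finset.mem_insert, h.ne_right_rung, false_or]
      exact h.notMem_of_notMem h.notMem₁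
    · simp only [Finset.mem_insert, h.ne_left_right, h.ne_left_rung, false_or]
      exact h.notMem_of_notMem h.notMem₀
  rw [TreeOn, TreeOn, h.card_insert_insert, hspan, hcard]
  constructor
  · rintro ⟨hs, hc⟩
    have hn : s(v₀, v₁) ∉ t := by
      -- otherwise `t` itself would span `W` with too few edges
      intro hmem
      rw [Finset.insert_eq_of_mem hmem] at hs
      have := hs.card_le ⟨v₀, h.mem₀⟩ h.edges
      lia
    rw [Finset.card_insert_of_notMem hn]
    exact ⟨hn, hs, by lia⟩
  · rintro ⟨hn, hs, hc⟩
    rw [Finset.card_insert_of_notMem hn] at hc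
    exact ⟨hs, by lia⟩

end NewColumn

end spans

/-! ### The transfer matrix of the ladder -/

/-- The product over `e ∈ E` of the weight `x e` if `e` is present in `t`, and `y e` otherwise. -/
noncomputable def pairWeight {ε : Type*} [DecidableEq ε] (x y : ε → ℝ) (E t : Finset ε) : ℝ :=
  ∏ e ∈ E, if e ∈ t then x e else y e

lemma sum_powerset_insert_pairWeight {ε : Type*} [DecidableEq ε] (x y : ε → ℝ) {E : Finset ε}
    {e : ε} (he : e ∉ E) (P : Finset ε → ℝ) :
    ∑ t ∈ (insert e E).powerset, P t * pairWeight x y (insert e E) t =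
      ∑ t ∈ E.powerset, (y e * P t + x e * P (insert e t)) * pairWeight x y E t := by
  rw [Finset.sum_powerset_insert he, ← Finset.sum_add_distrib]
  refine Finset.sum_congr rfl fun t ht => ?_
  rw [Finset.mem_powerset] at ht
  have het : e ∉ t := fun h => he (ht h)
  have h1 : pairWeight x y E (insert e t) = pairWeight x y E t := by
    refine Finset.prod_congr rfl fun f hf => ?_
    have : f ≠ e := by rintro rfl; exact he hf
    simp [this]
  have h2 : pairWeight x y (insert e E) t = y e * pairWeight x y E t := by
    rw [pairWeight, Finset.prod_insert he, if_neg het, pairWeight]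
  have h3 : pairWeight x y (insert e E) (insert e t) = x e * pairWeight x y E (insert e t) := by
    rw [pairWeight, Finset.prod_insert he, if_pos (by simp), pairWeight]
  rw [h3, h2, h1]
  ring

/-- The vertices of the ladder in the columns `a, …, a + m`. -/
noncomputable def ladderStrip (a : ℤ) (m : ℕ) : Finset LadderVertex := Finset.univ ×ˢ Finset.Icc a (a + m)

/-- The edges of the ladder between vertices in the columns `a, …, a + m`. -/
def ladderEdges (a : ℤ) : ℕ → Finset (Sym2 LadderVertex)
  | 0 => {rung a}
  | m + 1 => insert (rail 0 (a + m + 1)) (insert (rail 1 (a + m + 1))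
      (insert (rung (a + m + 1)) (ladderEdges a m)))

lemma rung_injective : Function.Injective rung := by
  intro m n h
  simp only [rung, Sym2.eq_iff, Prod.mk.injEq] at h
  simpa using h

lemma rail_ne_rung (i : Fin 2) (m n : ℤ) : rail i m ≠ rung n := by
  rw [rail, rung, Ne, Sym2.eq_iff]
  simp only [Prod.mk.injEq]
  lia

lemma rail_inj {i j : Fin 2} {m n : ℤ} (h : rail i m = rail j n) : i = j ∧ m = n := by
  rw [rail, rail, Sym2.eq_iff] at h
  simp only [Prod.mk.injEq] at h
  lia

lemma mem_ladderStrip {a : ℤ} {m : ℕ} {v : LadderVertex} :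
    v ∈ ladderStrip a m ↔ a ≤ v.2 ∧ v.2 ≤ a + m := by
  simp [ladderStrip]

lemma ladderStrip_zero (a : ℤ) : ladderStrip a 0 = {(0, a), (1, a)} := by
  ext ⟨i, k⟩
  rw [mem_ladderStrip]
  simp only [Finset.mem_insert, Finset.mem_singleton, Prod.mk.injEq]
  have : i = 0 ∨ i = 1 := by lia
  lia

lemma ladderStrip_succ (a : ℤ) (m : ℕ) :
    ladderStrip a (m + 1) =
      insert (0, a + m + 1) (insert (1, a + m + 1) (ladderStrip a m)) := by
  ext ⟨i, k⟩
  simp only [Finset.mem_insert, Prod.mk.injEq, mem_ladderStrip]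
  have : i = 0 ∨ i = 1 := by lia
  push_cast
  lia

lemma mem_ladderEdges {a : ℤ} {m : ℕ} {e : Sym2 LadderVertex} :
    e ∈ ladderEdges a m ↔ (∃ k, a ≤ k ∧ k ≤ a + m ∧ e = rung k) ∨
      ∃ i k, a < k ∧ k ≤ a + m ∧ e = rail i k := by
  induction m with
  | zero =>
    simp only [ladderEdges, Finset.mem_singleton, Nat.cast_zero, add_zero]
    constructor
    · rintro rfl
      exact Or.inl ⟨a, le_rfl, le_rfl, rfl⟩
    · rintro (⟨k, h1, h2, rfl⟩ | ⟨i, k, h1, h2, -⟩)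
      · rw [le_antisymm h2 h1]
      · lia
  | succ m ih =>
    simp only [ladderEdges, Finset.mem_insert, ih]
    push_cast
    constructor
    · rintro (rfl | rfl | rfl | ⟨k, h1, h2, rfl⟩ | ⟨i, k, h1, h2, rfl⟩)
      · exact Or.inr ⟨0, _, by lia, by lia, rfl⟩
      · exact Or.inr ⟨1, _, by lia, by lia, rfl⟩
      · exact Or.inl ⟨_, by lia, by lia, rfl⟩
      · exact Or.inl ⟨k, h1, by lia, rfl⟩
      · exact Or.inr ⟨i, k, h1, by lia, rfl⟩
    · rintro (⟨k, h1, h2, rfl⟩ | ⟨i, k, h1, h2, rfl⟩)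
      · by_cases h : k = a + m + 1
        · rw [h]; simp
        · exact Or.inr (Or.inr (Or.inr (Or.inl ⟨k, h1, by lia, rfl⟩)))
      · by_cases h : k = a + m + 1
        · have : i = 0 ∨ i = 1 := by lia
          rcases this with rfl | rfl <;> rw [h] <;> simp
        · exact Or.inr (Or.inr (Or.inr (Or.inr ⟨i, k, h1, by lia, rfl⟩)))

lemma ladderEdges_inside {a : ℤ} {m : ℕ} {u v : LadderVertex} (h : s(u, v) ∈ ladderEdges a m) :
    u ∈ ladderStrip a m ∧ v ∈ ladderStrip a m ∧ u ≠ v := by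
  rw [mem_ladderEdges] at h
  obtain ⟨i, p⟩ := u
  obtain ⟨j, q⟩ := v
  simp only [mem_ladderStrip, rung, rail, Sym2.eq_iff, Ne, Prod.mk.injEq] at h ⊢
  rcases h with ⟨k, h1, h2, h3⟩ | ⟨i, k, h1, h2, h3⟩ <;> lia

lemma newColumn_ladder (a : ℤ) (m : ℕ) {t : Finset (Sym2 LadderVertex)}
    (ht : t ⊆ ladderEdges a m) :
    NewColumn (ladderStrip a m) t (0, a + m) (1, a + m) (0, a + m + 1) (1, a + m + 1) where
  edges u v huv := ladderEdges_inside (ht huv)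
  mem₀ := by simp [mem_ladderStrip]
  mem₁ := by simp [mem_ladderStrip]
  ne := by simp
  notMem₀ := by simp [mem_ladderStrip]
  notMem₁ := by simp [mem_ladderStrip]
  ne' := by simp

/-- The edge set `t` becomes a spanning tree of the strip by adding the absent last rung: it has
two components, which separate the two vertices of the last column. -/
def SplitOn (a : ℤ) (m : ℕ) (t : Finset (Sym2 LadderVertex)) : Prop :=
  rung (a + m) ∉ t ∧ TreeOn (ladderStrip a m) (insert (rung (a + m)) t)

open Classical in
/-- The partition function of the spanning trees of the strip. -/
noncomputable def treeSum (x y : Sym2 LadderVertex → ℝ) (a : ℤ) (m : ℕ) : ℝ :=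
  ∑ t ∈ (ladderEdges a m).powerset,
    (if TreeOn (ladderStrip a m) t then 1 else 0) * pairWeight x y (ladderEdges a m) t

open Classical in
/-- The partition function of the edge sets satisfying `SplitOn`. -/
noncomputable def splitSum (x y : Sym2 LadderVertex → ℝ) (a : ℤ) (m : ℕ) : ℝ :=
  ∑ t ∈ (ladderEdges a m).powerset,
    (if SplitOn a m t then 1 else 0) * pairWeight x y (ladderEdges a m) t

/-- The transfer matrix of column `b`, which consists of the rails `h_{0,b}, h_{1,b}` and the rung
`z_b`, for weights `x` of present and `y` of absent edges. The states are `0` (spanning tree so far)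
and `1` (two components so far, see `SplitOn`). -/
def columnMatrix (x y : Sym2 LadderVertex → ℝ) (b : ℤ) : Matrix (Fin 2) (Fin 2) ℝ :=
  !![x (rail 0 b) * x (rail 1 b) * y (rung b) +
      (x (rail 0 b) * y (rail 1 b) + y (rail 0 b) * x (rail 1 b)) * x (rung b),
    (x (rail 0 b) * y (rail 1 b) + y (rail 0 b) * x (rail 1 b)) * y (rung b);
    x (rail 0 b) * x (rail 1 b) * x (rung b),
    x (rail 0 b) * x (rail 1 b) * y (rung b)]

/-- The ordered product `N (a + 1) * ⋯ * N (a + m)`. -/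
def stripProd (N : ℤ → Matrix (Fin 2) (Fin 2) ℝ) (a : ℤ) : ℕ → Matrix (Fin 2) (Fin 2) ℝ
  | 0 => 1
  | m + 1 => stripProd N a m * N (a + m + 1)

lemma treeOn_rung (a : ℤ) : TreeOn (ladderStrip a 0) {rung a} := by
  rw [TreeOn, ladderStrip_zero]
  refine ⟨fun f hf => ?_, by simp⟩
  have := hf (0, a) (1, a) (by simp [rung])
  simp only [Finset.mem_insert, Finset.mem_singleton]
  rintro u (rfl | rfl) v (rfl | rfl)
  exacts [Iff.rfl, this, this.symm, Iff.rfl]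

lemma not_treeOn_empty (a : ℤ) : ¬ TreeOn (ladderStrip a 0) ∅ := by
  rw [TreeOn, ladderStrip_zero]
  simp

lemma notMem_ladderEdges (a : ℤ) (m : ℕ) :
    rung (a + m + 1) ∉ ladderEdges a m ∧
      rail 1 (a + m + 1) ∉ insert (rung (a + m + 1)) (ladderEdges a m) ∧
      rail 0 (a + m + 1) ∉
        insert (rail 1 (a + m + 1)) (insert (rung (a + m + 1)) (ladderEdges a m)) := by
  have h1 : ∀ i, rail i (a + m + 1) ∉ ladderEdges a m := by
    intro i h
    rcases mem_ladderEdges.mp h with ⟨k, -, -, h⟩ | ⟨i, k, -, hk, h⟩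
    · exact rail_ne_rung _ _ _ h
    · have := (rail_inj h).2
      lia
  refine ⟨fun h => ?_, ?_, ?_⟩
  · rcases mem_ladderEdges.mp h with ⟨k, -, hk, h⟩ | ⟨i, k, -, hk, h⟩
    · have := rung_injective h
      lia
    · exact rail_ne_rung _ _ _ h.symm
  · simp [h1, rail_ne_rung]
  · have : rail 0 (a + m + 1) ≠ rail 1 (a + m + 1) := fun h => by simpa using (rail_inj h).1
    simp [h1, rail_ne_rung, this]

/-- One step of the transfer matrix: attaching column `a + m + 1` to the strip. -/
lemma treeSum_splitSum_succ (x y : Sym2 LadderVertex → ℝ) (a : ℤ) (m : ℕ) :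
    ![treeSum x y a (m + 1), splitSum x y a (m + 1)] =
      Matrix.vecMul ![treeSum x y a m, splitSum x y a m] (columnMatrix x y (a + m + 1)) := by
  classical
  obtain ⟨n1, n2, n3⟩ := notMem_ladderEdges a m
  have hr : ∀ i, rail i (a + m + 1) = s((i, a + m), (i, a + m + 1)) := by
    intro i; rw [rail, add_sub_cancel_right]
  have hne : ∀ i, rung (a + m + 1) ≠ rail i (a + m + 1) := fun i => (rail_ne_rung _ _ _).symm
  have hcast : a + ((m + 1 : ℕ) : ℤ) = a + m + 1 := by push_cast; ring
  have hC : treeSum x y a (m + 1) = treeSum x y a m * columnMatrix x y (a + m + 1) 0 0 +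
      splitSum x y a m * columnMatrix x y (a + m + 1) 1 0 := by
    rw [treeSum, ladderEdges, ladderStrip_succ, sum_powerset_insert_pairWeight x y n3,
      sum_powerset_insert_pairWeight x y n2, sum_powerset_insert_pairWeight x y n1,
      treeSum, splitSum, Finset.sum_mul, Finset.sum_mul, ← Finset.sum_add_distrib]
    refine Finset.sum_congr rfl fun t ht => ?_
    have h := newColumn_ladder a m (Finset.mem_powerset.mp ht)
    have e1 := h.not_treeOn_empty
    have e2 := h.not_treeOn_rung
    have e3 := h.not_treeOn_left
    have e4 := h.not_treeOn_right
    have e5 := h.treeOn_left_right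
    have e6 := h.treeOn_left_rung
    have e7 := h.treeOn_right_rung
    have e8 := h.treeOn_left_right_rung
    simp only [← hr, ← rung.eq_def] at e1 e2 e3 e4 e5 e6 e7 e8
    rw [← SplitOn] at e8
    simp only [e1, e2, e3, e4, e5, e6, e7, e8, if_false, columnMatrix, Matrix.of_apply,
      Matrix.cons_val_zero, Matrix.cons_val_one]
    ring
  have hD : splitSum x y a (m + 1) = treeSum x y a m * columnMatrix x y (a + m + 1) 0 1 +
      splitSum x y a m * columnMatrix x y (a + m + 1) 1 1 := by
    rw [splitSum, ladderEdges, sum_powerset_insert_pairWeight x y n3,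
      sum_powerset_insert_pairWeight x y n2, sum_powerset_insert_pairWeight x y n1,
      treeSum, splitSum, Finset.sum_mul, Finset.sum_mul, ← Finset.sum_add_distrib]
    refine Finset.sum_congr rfl fun t ht => ?_
    have h := newColumn_ladder a m (Finset.mem_powerset.mp ht)
    have hnt : rung (a + m + 1) ∉ t := fun h => n1 (Finset.mem_powerset.mp ht h)
    have e2 := h.not_treeOn_rung
    have e6 := h.treeOn_left_rung
    have e7 := h.treeOn_right_rung
    have e8 := h.treeOn_left_right_rung
    simp only [← hr, ← rung.eq_def] at e2 e6 e7 e8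
    rw [← SplitOn] at e8
    have c1 : ∀ i s, insert (rung (a + m + 1)) (insert (rail i (a + m + 1)) s) =
        insert (rail i (a + m + 1)) (insert (rung (a + m + 1)) s) := fun i s =>
      Finset.insert_comm _ _ _
    have d1 : ∀ t, SplitOn a (m + 1) t ↔ rung (a + m + 1) ∉ t ∧
        TreeOn (insert (0, a + m + 1) (insert (1, a + m + 1) (ladderStrip a m)))
          (insert (rung (a + m + 1)) t) := by
      intro t
      rw [SplitOn, ladderStrip_succ, hcast]
    simp only [d1, Finset.mem_insert, hne, hnt, c1, e2, e6, e7, e8, false_or, true_or, not_true,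
      not_false_eq_true, true_and, false_and, or_true, if_false, columnMatrix, Matrix.of_apply,
      Matrix.cons_val_zero, Matrix.cons_val_one]
    ring
  ext i
  fin_cases i
  · simp [hC, Matrix.vecMul, dotProduct, Fin.sum_univ_two]
  · simp [hD, Matrix.vecMul, dotProduct, Fin.sum_univ_two]

lemma treeSum_splitSum (x y : Sym2 LadderVertex → ℝ) (a : ℤ) (m : ℕ) :
    ![treeSum x y a m, splitSum x y a m] =
      Matrix.vecMul ![x (rung a), y (rung a)] (stripProd (columnMatrix x y) a m) := by
  induction m with
  | zero =>
    have hs : SplitOn a 0 ∅ := by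
      refine ⟨by simp, ?_⟩
      simpa using treeOn_rung a
    have hs' : ¬ SplitOn a 0 {rung a} := fun h => h.1 (by simp)
    have e : ({rung a} : Finset (Sym2 LadderVertex)).powerset = {∅, {rung a}} := by
      ext s
      simp [Finset.subset_singleton_iff]
    rw [stripProd, Matrix.vecMul_one, treeSum, splitSum, ladderEdges, e,
      Finset.sum_pair (by simp), Finset.sum_pair (by simp)]
    simp [pairWeight, hs, hs', treeOn_rung, not_treeOn_empty]
  | succ m ih =>
    rw [treeSum_splitSum_succ, ih, stripProd, Matrix.vecMul_vecMul]

lemma ladderBox_eq (n : ℕ) : ladderBox n = ladderStrip (-n) (2 * n) := by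
  rw [ladderBox, ladderStrip]
  congr 2
  push_cast
  ring

lemma mem_edgeSet_ladderGraph {e : Sym2 LadderVertex} :
    e ∈ ladderGraph.edgeSet ↔ (∃ m, e = rung m) ∨ ∃ i m, e = rail i m := by
  rw [ladderGraph, SimpleGraph.edgeSet_fromEdgeSet]
  refine ⟨fun h => h.1, fun h => ⟨h, ?_⟩⟩
  rcases h with ⟨m, rfl⟩ | ⟨i, m, rfl⟩
  · simp [rung]
  · simp [rail]

lemma mem_ladderEdges_iff_sym2 {a : ℤ} {m : ℕ} {e : Sym2 LadderVertex} :
    e ∈ ladderEdges a m ↔ e ∈ (ladderStrip a m).sym2 ∧ e ∈ ladderGraph.edgeSet := by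
  rw [mem_edgeSet_ladderGraph, mem_ladderEdges]
  constructor
  · rintro (⟨k, h1, h2, rfl⟩ | ⟨i, k, h1, h2, rfl⟩)
    · refine ⟨?_, Or.inl ⟨k, rfl⟩⟩
      simp only [rung, Finset.mk_mem_sym2_iff, mem_ladderStrip]
      lia
    · refine ⟨?_, Or.inr ⟨i, k, rfl⟩⟩
      simp only [rail, Finset.mk_mem_sym2_iff, mem_ladderStrip]
      lia
  · rintro ⟨h, ⟨k, rfl⟩ | ⟨i, k, rfl⟩⟩
    · simp only [rung, Finset.mk_mem_sym2_iff, mem_ladderStrip] at h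
      exact Or.inl ⟨k, by lia, by lia, rfl⟩
    · simp only [rail, Finset.mk_mem_sym2_iff, mem_ladderStrip] at h
      exact Or.inr ⟨i, k, by lia, by lia, rfl⟩

open Classical in
lemma spanningTrees_ladder (a : ℤ) (m : ℕ) :
    spanningTrees ladderGraph (ladderStrip a m) =
      (ladderEdges a m).powerset.filter (TreeOn (ladderStrip a m)) := by
  ext t
  simp only [spanningTrees, Finset.mem_filter, Finset.mem_powerset]
  have hsub : t ⊆ ladderEdges a m ↔
      t ⊆ (ladderStrip a m).sym2 ∧ (t : Set (Sym2 LadderVertex)) ⊆ ladderGraph.edgeSet := by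
    refine ⟨fun h => ⟨fun e he => (mem_ladderEdges_iff_sym2.mp (h he)).1,
      fun e he => (mem_ladderEdges_iff_sym2.mp (h he)).2⟩,
      fun h e he => mem_ladderEdges_iff_sym2.mpr ⟨h.1 he, h.2 he⟩⟩
  rw [← and_assoc, ← hsub]
  refine and_congr_right fun ht => isTree_induce_iff_treeOn ⟨(0, a), ?_⟩ ?_
  · simp [mem_ladderStrip]
  · exact fun u v huv => ladderEdges_inside (ht huv)

open Classical in
/-- The weight of a present edge which encodes the event that the tree agrees with `S` on `F`. -/
noncomputable def presentWeight (c : ℝ) (F : Finset (Sym2 LadderVertex))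
    (S : Set (Sym2 LadderVertex)) (e : Sym2 LadderVertex) : ℝ :=
  if e ∈ F → e ∈ S then ladderWeight c e else 0

open Classical in
/-- The weight of an absent edge which encodes the event that the tree agrees with `S` on `F`. -/
noncomputable def absentWeight (F : Finset (Sym2 LadderVertex))
    (S : Set (Sym2 LadderVertex)) (e : Sym2 LadderVertex) : ℝ :=
  if e ∈ F → e ∉ S then 1 else 0

open Classical in
lemma sum_spanningTrees_ladder (c : ℝ) (F : Finset (Sym2 LadderVertex))
    (S : Set (Sym2 LadderVertex)) (a : ℤ) (m : ℕ)
    (hF : ∀ e ∈ F, e ∈ S → e ∈ ladderEdges a m) {B : Set (Set (Sym2 LadderVertex))}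
    (hB : ∀ t, t ∈ B ↔ ∀ e ∈ F, e ∈ t ↔ e ∈ S) :
    ∑ t ∈ (spanningTrees ladderGraph (ladderStrip a m)).filter
        (fun t : Finset (Sym2 LadderVertex) => (t : Set (Sym2 LadderVertex)) ∈ B),
      treeWeight (ladderWeight c) t =
      treeSum (presentWeight c F S) (absentWeight F S) a m := by
  rw [spanningTrees_ladder, Finset.filter_filter, Finset.sum_filter, treeSum]
  refine Finset.sum_congr rfl fun t ht => ?_
  rw [Finset.mem_powerset] at ht
  by_cases h1 : TreeOn (ladderStrip a m) t
  · simp only [h1, true_and, if_true, one_mul]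
    by_cases h2 : ∀ e ∈ F, e ∈ t ↔ e ∈ S
    · have h2' : (t : Set (Sym2 LadderVertex)) ∈ B := (hB _).mpr h2
      have h3 : pairWeight (presentWeight c F S) (absentWeight F S) (ladderEdges a m) t =
          ∏ e ∈ ladderEdges a m, if e ∈ t then ladderWeight c e else 1 := by
        refine Finset.prod_congr rfl fun e _ => ?_
        by_cases het : e ∈ t
        · rw [if_pos het, if_pos het, presentWeight, if_pos fun heF => (h2 e heF).mp het]
        · rw [if_neg het, if_neg het, absentWeight, if_pos fun heF hS => het ((h2 e heF).mpr hS)]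
      rw [if_pos h2', h3, Finset.prod_ite_mem, Finset.inter_eq_right.mpr ht, treeWeight]
    · have h2' : (t : Set (Sym2 LadderVertex)) ∉ B := fun h => h2 ((hB _).mp h)
      rw [if_neg h2']
      push Not at h2
      obtain ⟨e, heF, h⟩ := h2
      symm
      rcases h with ⟨h3, h4⟩ | ⟨h3, h4⟩
      · refine Finset.prod_eq_zero (ht h3) ?_
        simp [h3, presentWeight, heF, h4]
      · refine Finset.prod_eq_zero (hF e heF h4) ?_
        simp [h3, absentWeight, heF, h4]
  · simp [h1]

/-! ### Asymptotics of the transfer matrix -/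

lemma stripProd_add (N : ℤ → Matrix (Fin 2) (Fin 2) ℝ) (a : ℤ) (m k : ℕ) :
    stripProd N a (m + k) = stripProd N a m * stripProd N (a + m) k := by
  induction k with
  | zero => simp [stripProd]
  | succ k ih =>
    rw [← add_assoc, stripProd, stripProd, ih, Matrix.mul_assoc]
    congr 3
    push_cast
    ring

lemma stripProd_congr {N N' : ℤ → Matrix (Fin 2) (Fin 2) ℝ} {a : ℤ} {m : ℕ}
    (h : ∀ b, a < b → b ≤ a + m → N b = N' b) : stripProd N a m = stripProd N' a m := by
  induction m with
  | zero => rfl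
  | succ m ih =>
    rw [stripProd, stripProd, ih fun b h1 h2 => h b h1 (by lia), h _ (by lia) (by lia)]

lemma stripProd_const (M : Matrix (Fin 2) (Fin 2) ℝ) (a : ℤ) (m : ℕ) :
    stripProd (fun _ => M) a m = M ^ m := by
  induction m with
  | zero => rfl
  | succ m ih => rw [stripProd, ih, pow_succ]

/-- The unrestricted transfer matrix. -/
def freeMatrix (c : ℝ) : Matrix (Fin 2) (Fin 2) ℝ := !![1 + 2 * c, 2; c, 1]

/-- The transfer matrix of a column whose rung is present. -/
def rungMatrix (c : ℝ) : Matrix (Fin 2) (Fin 2) ℝ := !![2 * c, 0; c, 0]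

/-- The left Perron eigenvector of the free transfer matrix, with eigenvalue `1 / α`. -/
def leftVec (α : ℝ) : Fin 2 → ℝ := ![1 - α, 2 * α]

/-- The right Perron eigenvector of the free transfer matrix, with eigenvalue `1 / α`. -/
def rightVec (α : ℝ) : Fin 2 → ℝ := ![2, 1 - α]

/-- The Perron projection of the free transfer matrix. -/
noncomputable def perron (α : ℝ) : Matrix (Fin 2) (Fin 2) ℝ :=
  (2 * (1 - α) * (1 + α))⁻¹ • Matrix.vecMulVec (rightVec α) (leftVec α)

lemma perron_eq (α : ℝ) :
    perron α = (2 * (1 - α) * (1 + α))⁻¹ •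
      !![2 * (1 - α), 4 * α; (1 - α) * (1 - α), (1 - α) * (2 * α)] := by
  rw [perron]
  congr 1
  ext i j
  fin_cases i <;> fin_cases j <;> simp [Matrix.vecMulVec, leftVec, rightVec]
  ring

section asymptotics

variable {α c : ℝ}

lemma perron_mul_perron (h0 : 0 < α) (h1 : α < 1) : perron α * perron α = perron α := by
  have h2 : 1 - α ≠ 0 := by linarith
  have h3 : 1 + α ≠ 0 := by linarith
  rw [perron_eq]
  ext i j
  fin_cases i <;> fin_cases j <;>
    simp [Matrix.mul_apply, Fin.sum_univ_two] <;> field_simp <;> ring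

/-- The spectral decomposition: the eigenvalues of `α M` are `1` and `α ^ 2`. -/
lemma smul_freeMatrix (h0 : 0 < α) (h1 : α < 1) (hc : 2 * α * c = (1 - α) ^ 2) :
    α • freeMatrix c = perron α + α ^ 2 • (1 - perron α) := by
  have h2 : 1 - α ≠ 0 := by linarith
  have h3 : 1 + α ≠ 0 := by linarith
  have hc' : c = (1 - α) ^ 2 / (2 * α) := by field_simp; linarith
  rw [perron_eq, freeMatrix, hc']
  ext i j
  fin_cases i <;> fin_cases j <;> simp <;> field_simp <;> ring

lemma smul_freeMatrix_pow (h0 : 0 < α) (h1 : α < 1) (hc : 2 * α * c = (1 - α) ^ 2) (n : ℕ) :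
    α ^ n • freeMatrix c ^ n = perron α + (α ^ 2) ^ n • (1 - perron α) := by
  have hP := perron_mul_perron h0 h1
  rw [← smul_pow]
  induction n with
  | zero => simp
  | succ n ih =>
    rw [pow_succ, ih, smul_freeMatrix h0 h1 hc, pow_succ (α ^ 2) n]
    generalize (α ^ 2) ^ n = s
    generalize α ^ 2 = t
    simp only [add_mul, mul_add, mul_sub, sub_mul, hP, smul_mul_assoc, mul_smul_comm, one_mul,
      mul_one]
    module

lemma tendsto_smul_freeMatrix_pow (h0 : 0 < α) (h1 : α < 1) (hc : 2 * α * c = (1 - α) ^ 2) :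
    Tendsto (fun n : ℕ => α ^ n • freeMatrix c ^ n) atTop (𝓝 (perron α)) := by
  simp only [smul_freeMatrix_pow h0 h1 hc]
  have h := tendsto_pow_atTop_nhds_zero_of_lt_one (sq_nonneg α) (by nlinarith : α ^ 2 < 1)
  simpa using tendsto_const_nhds.add (h.smul_const (1 - perron α))

/-- The limiting probability of an event that constrains the columns `a + 1, …, a + m` only, where
`N` collects the transfer matrices restricted to this event. -/
noncomputable def cylLimit (α : ℝ) (N : ℤ → Matrix (Fin 2) (Fin 2) ℝ) (a : ℤ) (m : ℕ) : ℝ :=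
  α ^ m * (leftVec α ⬝ᵥ Matrix.mulVec (stripProd N a m) (rightVec α)) / (2 * (1 - α) * (1 + α))

lemma perron_mul_mul_perron (Q : Matrix (Fin 2) (Fin 2) ℝ) :
    perron α * Q * perron α = ((leftVec α ⬝ᵥ Matrix.mulVec Q (rightVec α)) /
      (2 * (1 - α) * (1 + α))) • perron α := by
  rw [perron, Matrix.mul_assoc, mul_smul_comm, Matrix.mul_vecMulVec, smul_mul_smul_comm,
    Matrix.vecMulVec_mul_vecMulVec, Matrix.vecMulVec_smul, smul_smul, smul_smul]
  congr 1
  ring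

/-- The limit of the ratio of partition functions, in terms of transfer matrices. -/
lemma tendsto_stripProd_ratio (h0 : 0 < α) (h1 : α < 1) (hc : 2 * α * c = (1 - α) ^ 2)
    (N : ℤ → Matrix (Fin 2) (Fin 2) ℝ) (a : ℤ) (m : ℕ)
    (hN : ∀ b, b ≤ a ∨ a + m < b → N b = freeMatrix c) :
    Tendsto (fun n : ℕ => Matrix.vecMul ![c, 1] (stripProd N (-n) (2 * n)) 0 /
      Matrix.vecMul ![c, 1] (freeMatrix c ^ (2 * n)) 0) atTop (𝓝 (cylLimit α N a m)) := by
  have hc0 : 0 < c := by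
    have : 0 < 2 * α * c := by rw [hc]; exact sq_pos_of_pos (by linarith)
    exact pos_of_mul_pos_right this (by positivity)
  have hM := tendsto_smul_freeMatrix_pow h0 h1 hc
  -- numerator and denominator, rescaled by `α ^ (2 n)`
  have hden : Tendsto (fun n : ℕ => Matrix.vecMul ![c, 1] (α ^ (2 * n) • freeMatrix c ^ (2 * n)) 0)
      atTop (𝓝 (Matrix.vecMul ![c, 1] (perron α) 0)) := by
    have hcont : Continuous fun X : Matrix (Fin 2) (Fin 2) ℝ => Matrix.vecMul ![c, 1] X 0 := by
      simp only [Matrix.vecMul, dotProduct]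
      fun_prop
    exact (hcont.tendsto _).comp
      (hM.comp (tendsto_id.const_mul_atTop' (by norm_num : 0 < 2)))
  have hp : Tendsto (fun n : ℕ => (a + n).toNat) atTop atTop := by
    refine tendsto_atTop.mpr fun k => ?_
    filter_upwards [eventually_ge_atTop (k + a.natAbs)] with n hn
    lia
  have hq : Tendsto (fun n : ℕ => (n - a - m).toNat) atTop atTop := by
    refine tendsto_atTop.mpr fun k => ?_
    filter_upwards [eventually_ge_atTop (k + a.natAbs + m)] with n hn
    lia
  have hnum : Tendsto (fun n : ℕ => Matrix.vecMul ![c, 1]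
      (α ^ (2 * n) • stripProd N (-n) (2 * n)) 0) atTop
      (𝓝 (Matrix.vecMul ![c, 1] (perron α * (α ^ m • stripProd N a m) * perron α) 0)) := by
    have hcont : Continuous fun X : Matrix (Fin 2) (Fin 2) ℝ => Matrix.vecMul ![c, 1] X 0 := by
      simp only [Matrix.vecMul, dotProduct]
      fun_prop
    refine (hcont.tendsto _).comp ?_
    refine (((hM.comp hp).mul tendsto_const_nhds).mul (hM.comp hq)).congr' ?_
    filter_upwards [eventually_ge_atTop (a.natAbs + m)] with n hn
    obtain ⟨p, hp⟩ : ∃ p : ℕ, a + n = p := ⟨(a + n).toNat, by lia⟩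
    obtain ⟨q, hq⟩ : ∃ q : ℕ, n - a - m = q := ⟨(n - a - m).toNat, by lia⟩
    have e : 2 * n = p + m + q := by lia
    have ha : -(n : ℤ) + p = a := by lia
    have c1 : stripProd N (-n) p = freeMatrix c ^ p := by
      rw [← stripProd_const (freeMatrix c) (-n) p]
      exact stripProd_congr fun b _ h2 => hN b (Or.inl (by lia))
    have c2 : stripProd N (a + m) q = freeMatrix c ^ q := by
      rw [← stripProd_const (freeMatrix c) (a + m) q]
      exact stripProd_congr fun b h2 _ => hN b (Or.inr (by lia))
    have ha' : -(n : ℤ) + (p + m : ℕ) = a + m := by lia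
    simp only [Function.comp_apply, hp, hq, Int.toNat_natCast]
    rw [e, stripProd_add, stripProd_add, ha, ha', c1, c2, pow_add, pow_add]
    simp only [smul_mul_assoc, mul_smul_comm, smul_smul]
    congr 1
    ring
  have hpos : 0 < Matrix.vecMul ![c, 1] (perron α) 0 := by
    rw [perron_eq]
    have h2 : 0 < 1 - α := by linarith
    simp [Matrix.vecMul, dotProduct, Fin.sum_univ_two]
    positivity
  have h := hnum.div hden hpos.ne'
  have hlim : Matrix.vecMul ![c, 1] (perron α * (α ^ m • stripProd N a m) * perron α) 0 /
      Matrix.vecMul ![c, 1] (perron α) 0 = cylLimit α N a m := by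
    rw [perron_mul_mul_perron, Matrix.vecMul_smul, Pi.smul_apply, smul_eq_mul,
      mul_div_assoc, div_self hpos.ne', mul_one, cylLimit, Matrix.smul_mulVec, dotProduct_smul,
      smul_eq_mul]
  rw [hlim] at h
  refine h.congr fun n => ?_
  simp only [Pi.div_apply]
  rw [Matrix.vecMul_smul, Matrix.vecMul_smul, Pi.smul_apply, Pi.smul_apply, smul_eq_mul,
    smul_eq_mul, mul_div_mul_left _ _ (by positivity)]

lemma ladderWeight_rung (c : ℝ) (b : ℤ) : ladderWeight c (rung b) = c :=
  if_pos ⟨b, rfl⟩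

lemma ladderWeight_rail (c : ℝ) (i : Fin 2) (b : ℤ) : ladderWeight c (rail i b) = 1 :=
  if_neg fun ⟨_, h⟩ => rail_ne_rung _ _ _ h

/-- No edge of column `b` belongs to `F`. -/
def AvoidsColumn (F : Finset (Sym2 LadderVertex)) (b : ℤ) : Prop :=
  rung b ∉ F ∧ ∀ i, rail i b ∉ F

lemma columnMatrix_of_avoids {F : Finset (Sym2 LadderVertex)} {S : Set (Sym2 LadderVertex)}
    {b : ℤ} (h : AvoidsColumn F b) :
    columnMatrix (presentWeight c F S) (absentWeight F S) b = freeMatrix c := by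
  ext i j
  have h1 := h.1
  have h2 := h.2
  fin_cases i <;> fin_cases j <;>
    simp only [columnMatrix, presentWeight, absentWeight, h1, h2, freeMatrix, ladderWeight_rail,
      ladderWeight_rung, false_imp_iff, if_true] <;> norm_num

lemma treeSum_eq {F : Finset (Sym2 LadderVertex)} {S : Set (Sym2 LadderVertex)} {a : ℤ}
    (h : AvoidsColumn F a) (m : ℕ) :
    treeSum (presentWeight c F S) (absentWeight F S) a m = Matrix.vecMul ![c, 1]
      (stripProd (columnMatrix (presentWeight c F S) (absentWeight F S)) a m) 0 := by
  have h2 := congrFun (treeSum_splitSum (presentWeight c F S) (absentWeight F S) a m) 0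
  have e1 : presentWeight c F S (rung a) = c := by
    simp [presentWeight, h.1, ladderWeight_rung]
  have e2 : absentWeight F S (rung a) = 1 := by simp [absentWeight, h.1]
  rw [e1, e2] at h2
  exact h2

lemma totalWeight_eq (c : ℝ) (n : ℕ) :
    ∑ t ∈ spanningTrees ladderGraph (ladderBox n), treeWeight (ladderWeight c) t =
      Matrix.vecMul ![c, 1] (freeMatrix c ^ (2 * n)) 0 := by
  have h := sum_spanningTrees_ladder c ∅ ∅ (-n) (2 * n) (by simp)
    (B := univ) (by simp)
  rw [treeSum_eq ⟨by simp, by simp⟩, stripProd_congr (N' := fun _ => freeMatrix c)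
    (fun b _ _ => columnMatrix_of_avoids ⟨by simp, by simp⟩), stripProd_const, ← ladderBox_eq] at h
  simpa using h

lemma totalWeight_pos (hc : 0 < c) (n : ℕ) :
    0 < ∑ t ∈ spanningTrees ladderGraph (ladderBox n), treeWeight (ladderWeight c) t := by
  rw [totalWeight_eq]
  have : ∀ m : ℕ, 0 < Matrix.vecMul ![c, 1] (freeMatrix c ^ m) 0 ∧
      0 < Matrix.vecMul ![c, 1] (freeMatrix c ^ m) 1 := by
    intro m
    induction m with
    | zero => simp [hc]
    | succ m ih =>
      obtain ⟨h1, h2⟩ := ih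
      rw [pow_succ, ← Matrix.vecMul_vecMul]
      set v := Matrix.vecMul ![c, 1] (freeMatrix c ^ m)
      simp only [Matrix.vecMul, dotProduct, Fin.sum_univ_two, freeMatrix, Matrix.of_apply,
        Matrix.cons_val_zero, Matrix.cons_val_one]
      constructor <;> positivity
  exact (this _).1

lemma tendsto_treeProb_window (h0 : 0 < α) (h1 : α < 1) (hc : 2 * α * c = (1 - α) ^ 2)
    {F : Finset (Sym2 LadderVertex)} {S : Set (Sym2 LadderVertex)} {a : ℤ} {m : ℕ}
    (hF : ∀ b, b ≤ a ∨ a + m < b → AvoidsColumn F b)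
    (hS : ∀ e ∈ F, e ∈ S → e ∈ ladderGraph.edgeSet) :
    Tendsto (fun n : ℕ => treeProb ladderGraph (ladderBox n) (ladderWeight c)
      {t | ∀ e ∈ F, e ∈ t ↔ e ∈ S}) atTop
      (𝓝 (cylLimit α (columnMatrix (presentWeight c F S) (absentWeight F S)) a m)) := by
  refine (tendsto_stripProd_ratio h0 h1 hc _ a m
    fun b hb => columnMatrix_of_avoids (hF b hb)).congr' ?_
  filter_upwards [eventually_ge_atTop (a.natAbs + m)] with n hn
  have hin : ∀ e ∈ F, e ∈ S → e ∈ ladderEdges (-n) (2 * n) := by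
    intro e heF heS
    have hab : ∀ b, ¬ AvoidsColumn F b → a < b ∧ b ≤ a + m := by
      intro b hb
      by_contra h
      exact hb (hF b (by lia))
    rw [mem_ladderEdges]
    rcases mem_edgeSet_ladderGraph.mp (hS e heF heS) with ⟨b, rfl⟩ | ⟨i, b, rfl⟩
    · have := hab b fun h => h.1 heF
      exact Or.inl ⟨b, by lia, by lia, rfl⟩
    · have := hab b fun h => h.2 i heF
      exact Or.inr ⟨i, b, by lia, by lia, rfl⟩
  rw [treeProb, totalWeight_eq, ← treeSum_eq (hF (-n) (Or.inl (by lia))), ladderBox_eq]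
  congr 1
  exact (sum_spanningTrees_ladder c F S (-n) (2 * n) hin fun t => Iff.rfl).symm

/-- The tree probabilities of all cylinder events converge. -/
lemma exists_tendsto_treeProb (h0 : 0 < α) (h1 : α < 1) (hc : 2 * α * c = (1 - α) ^ 2)
    (F : Finset (Sym2 LadderVertex)) (S : Set (Sym2 LadderVertex)) :
    ∃ q, Tendsto (fun n : ℕ => treeProb ladderGraph (ladderBox n) (ladderWeight c)
      {t | ∀ e ∈ F, e ∈ t ↔ e ∈ S}) atTop (𝓝 q) := by
  by_cases hS : ∀ e ∈ F, e ∈ S → e ∈ ladderGraph.edgeSet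
  · have hfin : {b | ¬ AvoidsColumn F b}.Finite := by
      have hsub : {b | ¬ AvoidsColumn F b} ⊆
          rung ⁻¹' F ∪ (rail 0 ⁻¹' F ∪ rail 1 ⁻¹' F) := by
        intro b hb
        by_contra h
        apply hb
        simp only [mem_union, mem_preimage, Finset.mem_coe, not_or] at h
        refine ⟨h.1, fun i => ?_⟩
        have : i = 0 ∨ i = 1 := by lia
        rcases this with rfl | rfl
        exacts [h.2.1, h.2.2]
      have hr : ∀ i, Function.Injective (rail i) := fun i m n h => (rail_inj h).2
      refine Set.Finite.subset ?_ hsub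
      exact (F.finite_toSet.preimage rung_injective.injOn).union
        ((F.finite_toSet.preimage (hr 0).injOn).union (F.finite_toSet.preimage (hr 1).injOn))
    obtain ⟨l, hl⟩ := hfin.bddBelow
    obtain ⟨u, hu⟩ := hfin.bddAbove
    refine ⟨_, tendsto_treeProb_window (a := l - 1) (m := (u - l + 1).toNat) h0 h1 hc ?_ hS⟩
    intro b hb
    by_contra h
    have h2 := hl h
    have h3 := hu h
    lia
  · push Not at hS
    obtain ⟨e, heF, heS, he⟩ := hS
    refine ⟨0, tendsto_const_nhds.congr fun n => ?_⟩
    rw [treeProb, Finset.sum_eq_zero, zero_div]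
    intro t ht
    simp only [Finset.mem_filter, spanningTrees] at ht
    exact absurd (ht.1.2.1 ((ht.2 e heF).mpr heS)) he

end asymptotics

/-! ### The limit measure -/

lemma measurableSet_agree {ε : Type*} (F : Finset ε) (S : Set ε) :
    MeasurableSet {t : Set ε | ∀ e ∈ F, e ∈ t ↔ e ∈ S} := by
  have : {t : Set ε | ∀ e ∈ F, e ∈ t ↔ e ∈ S} = ⋂ e ∈ F, {t : Set ε | e ∈ t ↔ e ∈ S} := by
    ext t; simp
  rw [this]
  refine F.measurableSet_biInter fun e _ => ?_
  by_cases h : e ∈ S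
  · simpa [h] using measurableSet_setOfPred.mpr (measurable_set_mem e)
  · have h2 : {t : Set ε | e ∈ t ↔ e ∈ S} = {t | e ∈ t}ᶜ := by ext t; simp [h]
    rw [h2]
    exact (measurableSet_setOfPred.mpr (measurable_set_mem e)).compl

/-- The set of the indices at which a binary configuration equals `1`. The limit of measures is taken
on configurations, which form a compact metrizable space, and transported to sets by this map. -/
def supportSet {ε : Type*} (x : ε → Bool) : Set ε := {e | x e = true}

lemma measurable_supportSet {ε : Type*} : Measurable (supportSet : (ε → Bool) → Set ε) := by
  rw [measurable_set_iff]
  intro e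
  exact measurableSet_setOfPred.mp (measurableSet_apply_eq e true)

open Classical in
/-- The binary configuration of a set. -/
noncomputable def indicatorConfig {ε : Type*} (t : Set ε) (e : ε) : Bool := decide (e ∈ t)

lemma measurable_indicatorConfig {ε : Type*} :
    Measurable (indicatorConfig : Set ε → ε → Bool) := by
  refine measurable_pi_lambda _ fun e => measurable_to_bool ?_
  have : (fun t : Set ε => indicatorConfig t e) ⁻¹' {true} = {t | e ∈ t} := by
    ext t; simp [indicatorConfig]
  rw [this]
  exact measurableSet_setOfPred.mpr (measurable_set_mem e)

lemma supportSet_indicatorConfig {ε : Type*} (t : Set ε) : supportSet (indicatorConfig t) = t := by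
  ext e; simp [supportSet, indicatorConfig]

/-- A probability measure on sets is determined by the probabilities of containing finite sets. -/
lemma measure_set_ext {ε : Type*} {P Q : Measure (Set ε)} [IsFiniteMeasure P]
    (h : ∀ F : Finset ε, P {t | ∀ e ∈ F, e ∈ t ↔ e ∈ (univ : Set ε)} =
      Q {t | ∀ e ∈ F, e ∈ t ↔ e ∈ (univ : Set ε)}) : P = Q := by
  have key : P.map indicatorConfig = Q.map indicatorConfig := by
    refine ext_of_onesOn fun F => ?_
    rw [Measure.map_apply measurable_indicatorConfig (measurableSet_onesOn F),
      Measure.map_apply measurable_indicatorConfig (measurableSet_onesOn F)]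
    convert h F using 2 <;>
    · ext t; simp [onesOn, indicatorConfig]
  have h2 := congrArg (Measure.map supportSet) key
  rw [Measure.map_map measurable_supportSet measurable_indicatorConfig,
    Measure.map_map measurable_supportSet measurable_indicatorConfig] at h2
  have hid : (supportSet ∘ indicatorConfig : Set ε → Set ε) = id :=
    funext supportSet_indicatorConfig
  rwa [hid, Measure.map_id, Measure.map_id] at h2

lemma IsLadderTreeMeasure.unique {c : ℝ} {P Q : Measure (Set (Sym2 LadderVertex))}
    (hP : IsLadderTreeMeasure c P) (hQ : IsLadderTreeMeasure c Q) : P = Q := by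
  have := hP.1
  have := hQ.1
  refine measure_set_ext fun F => ?_
  rw [← measureReal_eq_measureReal_iff]
  exact tendsto_nhds_unique (hP.2 F univ) (hQ.2 F univ)

open Classical in
/-- The spanning tree measure of a finite subgraph, as a measure on edge configurations. -/
noncomputable def finiteTreeLaw {V : Type*} (G : SimpleGraph V) (W : Finset V) (w : Sym2 V → ℝ) :
    Measure (Sym2 V → Bool) :=
  ∑ t ∈ spanningTrees G W, ENNReal.ofReal (treeWeight w t / ∑ t ∈ spanningTrees G W, treeWeight w t) •
    Measure.dirac (indicatorConfig (t : Set (Sym2 V)))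

lemma finiteTreeLaw_real {V : Type*} (G : SimpleGraph V) (W : Finset V) (w : Sym2 V → ℝ)
    (hw : ∀ e, 0 ≤ w e) {B : Set (Set (Sym2 V))} (hB : MeasurableSet B) :
    (finiteTreeLaw G W w).real (supportSet ⁻¹' B) = treeProb G W w B := by
  classical
  have hnn : ∀ t, 0 ≤ treeWeight w t := fun t => Finset.prod_nonneg fun e _ => hw e
  have hnn' : ∀ t, 0 ≤ treeWeight w t / ∑ t ∈ spanningTrees G W, treeWeight w t := fun t =>
    div_nonneg (hnn t) (Finset.sum_nonneg fun t _ => hnn t)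
  rw [measureReal_def, finiteTreeLaw, Measure.finsetSum_apply, ENNReal.toReal_sum, treeProb,
    Finset.sum_filter, Finset.sum_div]
  · refine Finset.sum_congr rfl fun t _ => ?_
    rw [Measure.smul_apply, Measure.dirac_apply' _ (measurable_supportSet hB), smul_eq_mul,
      ENNReal.toReal_mul, ENNReal.toReal_ofReal (hnn' t)]
    by_cases h : (t : Set (Sym2 V)) ∈ B
    · simp [h, supportSet_indicatorConfig]
    · simp [h, supportSet_indicatorConfig]
  · intro t _
    rw [Measure.smul_apply]
    exact ENNReal.mul_ne_top ENNReal.ofReal_ne_top (measure_ne_top _ _)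

lemma isProbabilityMeasure_finiteTreeLaw {V : Type*} (G : SimpleGraph V) (W : Finset V)
    (w : Sym2 V → ℝ) (hw : ∀ e, 0 ≤ w e) (hpos : 0 < ∑ t ∈ spanningTrees G W, treeWeight w t) :
    IsProbabilityMeasure (finiteTreeLaw G W w) := by
  have h := finiteTreeLaw_real G W w hw (B := univ) MeasurableSet.univ
  rw [treeProb] at h
  simp only [mem_univ, Finset.filter_true, preimage_univ, div_self hpos.ne'] at h
  rw [measureReal_def, ENNReal.toReal_eq_one_iff] at h
  exact ⟨h⟩

lemma ladderWeight_nonneg {c : ℝ} (hc : 0 ≤ c) (e : Sym2 LadderVertex) : 0 ≤ ladderWeight c e := by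
  rw [ladderWeight]
  split_ifs
  exacts [hc, zero_le_one]

lemma isClopen_agree {ε : Type*} (F : Finset ε) (S : Set ε) :
    IsClopen (supportSet ⁻¹' {t : Set ε | ∀ e ∈ F, e ∈ t ↔ e ∈ S}) := by
  have : supportSet ⁻¹' {t : Set ε | ∀ e ∈ F, e ∈ t ↔ e ∈ S} =
      ⋂ e ∈ F, (fun x : ε → Bool => x e) ⁻¹' {b | b = true ↔ e ∈ S} := by
    ext x; simp [supportSet]
  rw [this]
  exact isClopen_biInter_finset fun e _ => (isClopen_discrete _).preimage (continuous_apply e)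

/-- A cluster point of the finite tree laws exists by compactness, and it charges each cylinder
event, which is clopen, with the limit of the tree probabilities. -/
lemma exists_isLadderTreeMeasure {α c : ℝ} (h0 : 0 < α) (h1 : α < 1)
    (hc : 2 * α * c = (1 - α) ^ 2) : ∃ P, IsLadderTreeMeasure c P := by
  have hc0 : 0 < c := by
    have : 0 < 2 * α * c := by rw [hc]; exact sq_pos_of_pos (by linarith)
    exact pos_of_mul_pos_right this (by positivity)
  have hw := ladderWeight_nonneg hc0.le
  obtain ⟨μ, hμ⟩ : ∃ μ : ℕ → ProbabilityMeasure (Sym2 LadderVertex → Bool), ∀ n,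
      (μ n : Measure (Sym2 LadderVertex → Bool)) =
        finiteTreeLaw ladderGraph (ladderBox n) (ladderWeight c) :=
    ⟨fun n => ⟨_, isProbabilityMeasure_finiteTreeLaw _ _ _ hw (totalWeight_pos hc0 n)⟩,
      fun _ => rfl⟩
  obtain ⟨ν, -, hν⟩ := isCompact_univ.ultrafilter_le_nhds ((hyperfilter ℕ).map μ) (by simp)
  have hν : Tendsto μ (hyperfilter ℕ : Filter ℕ) (𝓝 ν) := hν
  refine ⟨(ν : Measure (Sym2 LadderVertex → Bool)).map supportSet,
    Measure.isProbabilityMeasure_map measurable_supportSet.aemeasurable, fun F S => ?_⟩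
  obtain ⟨q, hq⟩ := exists_tendsto_treeProb h0 h1 hc F S
  have hB := measurableSet_agree F S
  have hlim := ProbabilityMeasure.tendsto_measure_of_null_frontier_of_tendsto' hν
    (E := supportSet ⁻¹' {t : Set (Sym2 LadderVertex) | ∀ e ∈ F, e ∈ t ↔ e ∈ S})
    (by rw [(isClopen_agree F S).frontier_eq]; simp)
  have hlim2 := (ENNReal.tendsto_toReal (measure_ne_top _ _)).comp hlim
  have hlim3 : Tendsto (fun n : ℕ => treeProb ladderGraph (ladderBox n) (ladderWeight c)
      {t | ∀ e ∈ F, e ∈ t ↔ e ∈ S}) (hyperfilter ℕ : Filter ℕ)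
      (𝓝 ((ν : Measure (Sym2 LadderVertex → Bool)).real
        (supportSet ⁻¹' {t : Set (Sym2 LadderVertex) | ∀ e ∈ F, e ∈ t ↔ e ∈ S}))) := by
    refine hlim2.congr fun n => ?_
    rw [Function.comp_apply, hμ, ← measureReal_def, finiteTreeLaw_real _ _ _ hw hB]
  have := tendsto_nhds_unique hlim3 (hq.mono_left Nat.hyperfilter_le_atTop)
  rw [map_measureReal_apply measurable_supportSet hB, this]
  exact hq

lemma isLadderTreeMeasure_ladderTreeMeasure {α c : ℝ} (h0 : 0 < α) (h1 : α < 1)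
    (hc : 2 * α * c = (1 - α) ^ 2) : IsLadderTreeMeasure c (ladderTreeMeasure c) := by
  have h := exists_isLadderTreeMeasure h0 h1 hc
  rw [ladderTreeMeasure, dif_pos h]
  exact h.choose_spec

/-! ### The rung process -/

open Classical in
/-- The transfer matrices for the event that all rungs at `S` are present. -/
noncomputable def occupiedMatrix (c : ℝ) (S : Finset ℤ) (b : ℤ) : Matrix (Fin 2) (Fin 2) ℝ :=
  if b ∈ S then rungMatrix c else freeMatrix c

lemma measurable_rungIndicator : Measurable rungIndicator := by
  refine measurable_pi_lambda _ fun m => measurable_to_bool ?_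
  have : (fun t => rungIndicator t m) ⁻¹' {true} = {t | rung m ∈ t} := by
    ext t; simp [rungIndicator]
  rw [this]
  exact measurableSet_setOfPred.mpr (measurable_set_mem _)

section rungs

variable {α c : ℝ}

lemma real_onesOn_rungs (h0 : 0 < α) (h1 : α < 1) (hc : 2 * α * c = (1 - α) ^ 2)
    (S : Finset ℤ) (a : ℤ) (m : ℕ) (hS : ∀ s ∈ S, a < s ∧ s ≤ a + m) :
    ((ladderTreeMeasure c).map rungIndicator).real (onesOn S) =
      cylLimit α (occupiedMatrix c S) a m := by
  have hrung : ∀ b, rung b ∈ S.image rung ↔ b ∈ S := fun b =>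
    rung_injective.mem_finset_image
  have hrail : ∀ i b, rail i b ∉ S.image rung := by
    intro i b h
    obtain ⟨s, -, h⟩ := Finset.mem_image.mp h
    exact rail_ne_rung _ _ _ h.symm
  have e : rungIndicator ⁻¹' onesOn S =
      {t | ∀ e ∈ S.image rung, e ∈ t ↔ e ∈ (univ : Set (Sym2 LadderVertex))} := by
    ext t
    simp [onesOn, rungIndicator]
  rw [map_measureReal_apply measurable_rungIndicator (measurableSet_onesOn S), e]
  refine tendsto_nhds_unique ((isLadderTreeMeasure_ladderTreeMeasure h0 h1 hc).2 _ _) ?_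
  have h := tendsto_treeProb_window h0 h1 hc (F := S.image rung) (S := univ) (a := a) (m := m)
    (fun b hb => ⟨fun h => by
      have := hS b ((hrung b).mp h)
      lia, fun i => hrail i b⟩)
    (fun e he _ => by
      obtain ⟨s, -, rfl⟩ := Finset.mem_image.mp he
      exact mem_edgeSet_ladderGraph.mpr (Or.inl ⟨s, rfl⟩))
  have hN : columnMatrix (presentWeight c (S.image rung) univ) (absentWeight (S.image rung) univ) =
      occupiedMatrix c S := by
    funext b
    rw [occupiedMatrix]
    split_ifs with hb
    · ext i j
      fin_cases i <;> fin_cases j <;>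
        simp only [columnMatrix, presentWeight, absentWeight, hrung, hrail, hb, rungMatrix,
          ladderWeight_rail, ladderWeight_rung, mem_univ] <;> norm_num
    · exact columnMatrix_of_avoids ⟨fun h => hb ((hrung b).mp h), fun i => hrail i b⟩
  rwa [hN] at h

lemma rungMatrix_mul_mul (c : ℝ) (X : Matrix (Fin 2) (Fin 2) ℝ) :
    rungMatrix c * X * rungMatrix c = (c * (2 * X 0 0 + X 0 1)) • rungMatrix c := by
  ext i j
  fin_cases i <;> fin_cases j <;>
    simp only [Matrix.mul_apply, Matrix.smul_apply, Fin.sum_univ_two, rungMatrix, Matrix.of_apply,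
      Fin.mk_zero, Fin.mk_one, Matrix.cons_val_zero, Matrix.cons_val_one,
      smul_eq_mul] <;> ring

/-- Passing from one present rung to another one at distance `d`. The factor is the expected one
since `rungMatrix c` has rank one. -/
lemma rungMatrix_mul_pow_mul (h0 : 0 < α) (h1 : α < 1) (hc : 2 * α * c = (1 - α) ^ 2) (d : ℕ) :
    α ^ (d + 1) • (rungMatrix c * freeMatrix c ^ d * rungMatrix c) =
      ((1 - α) / (1 + α) * (1 - α ^ (2 * (d + 1)))) • rungMatrix c := by
  have h2 : 1 - α ≠ 0 := by linarith
  have h3 : 1 + α ≠ 0 := by linarith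
  have hc' : c = (1 - α) ^ 2 / (2 * α) := by field_simp; linarith
  have e : α ^ (d + 1) • (rungMatrix c * freeMatrix c ^ d * rungMatrix c) =
      α • (rungMatrix c * (α ^ d • freeMatrix c ^ d) * rungMatrix c) := by
    simp only [mul_smul_comm, smul_mul_assoc, smul_smul, pow_succ']
  have e2 : α ^ (2 * (d + 1)) = α ^ 2 * (α ^ 2) ^ d := by ring
  rw [e, e2, rungMatrix_mul_mul, smul_freeMatrix_pow h0 h1 hc, smul_smul]
  generalize (α ^ 2) ^ d = s
  congr 1
  rw [perron_eq, hc']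
  simp
  field_simp
  ring

lemma geomCorr_rungs (h0 : 0 < α) (h1 : α < 1) (hc : 2 * α * c = (1 - α) ^ 2) :
    GeomCorr ((ladderTreeMeasure c).map rungIndicator) ((1 - α) / (1 + α)) α := by
  have := (isLadderTreeMeasure_ladderTreeMeasure h0 h1 hc).1
  have h2 : 1 - α ≠ 0 := by linarith
  have h3 : 1 + α ≠ 0 := by linarith
  have hc' : c = (1 - α) ^ 2 / (2 * α) := by field_simp; linarith
  refine ⟨Measure.isProbabilityMeasure_map measurable_rungIndicator.aemeasurable, fun a => ?_,
    fun S a b hb hS hab => ?_⟩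
  · rw [real_onesOn_rungs h0 h1 hc {a} (a - 1) 1 (by simp), cylLimit, stripProd, stripProd,
      Matrix.one_mul, occupiedMatrix, if_pos (by simp), rungMatrix, hc']
    simp [Matrix.mulVec, dotProduct, Fin.sum_univ_two, leftVec, rightVec]
    field_simp
    ring
  · -- a window `(l, l + k + 1]` ending at `b`, and its extension to `a = b + d + 1`
    obtain ⟨l, hl⟩ := S.bddBelow
    have hlb := hl hb
    obtain ⟨k, hk⟩ : ∃ k : ℕ, b = l - 1 + k + 1 := ⟨(b - l).toNat, by lia⟩
    obtain ⟨d, hd⟩ : ∃ d : ℕ, a = b + d + 1 := ⟨(a - b - 1).toNat, by lia⟩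
    have hdn : (a - b).toNat = d + 1 := by lia
    have w1 := real_onesOn_rungs h0 h1 hc S (l - 1) (k + 1) fun s hs => by
      have := hl hs
      have := hS s hs
      push_cast
      lia
    have w2 := real_onesOn_rungs h0 h1 hc (insert a S) (l - 1) (k + 1 + (d + 1)) fun s hs => by
      rcases Finset.mem_insert.mp hs with rfl | hs
      · push_cast
        lia
      · have := hl hs
        have := hS s hs
        push_cast
        lia
    have p1 : stripProd (occupiedMatrix c S) (l - 1) (k + 1) =
        stripProd (occupiedMatrix c S) (l - 1) k * rungMatrix c := by
      rw [stripProd, ← hk, occupiedMatrix, if_pos hb]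
    have p2 : stripProd (occupiedMatrix c (insert a S)) (l - 1) (k + 1) =
        stripProd (occupiedMatrix c S) (l - 1) (k + 1) := by
      refine stripProd_congr fun x _ hx => ?_
      have : x ≠ a := by
        push_cast at hx
        lia
      simp [occupiedMatrix, this]
    have p3 : stripProd (occupiedMatrix c (insert a S)) b (d + 1) =
        freeMatrix c ^ d * rungMatrix c := by
      rw [stripProd, ← hd, occupiedMatrix, if_pos (by simp), ← stripProd_const (freeMatrix c) b d]
      congr 1
      refine stripProd_congr fun x hx hx' => ?_
      have h4 : x ≠ a := by lia
      have h5 : x ∉ S := fun h => absurd (hS x h) (by lia)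
      simp [occupiedMatrix, h4, h5]
    have e : l - 1 + ((k + 1 : ℕ) : ℤ) = b := by
      push_cast
      lia
    have p4 : α ^ (k + 1 + (d + 1)) •
        stripProd (occupiedMatrix c (insert a S)) (l - 1) (k + 1 + (d + 1)) =
        ((1 - α) / (1 + α) * (1 - α ^ (2 * (d + 1)))) •
          (α ^ (k + 1) • stripProd (occupiedMatrix c S) (l - 1) (k + 1)) := by
      rw [stripProd_add, e, p3, p2, p1, pow_add, mul_smul, Matrix.mul_assoc,
        ← Matrix.mul_assoc (rungMatrix c), ← mul_smul_comm (α ^ (d + 1)),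
        rungMatrix_mul_pow_mul h0 h1 hc, mul_smul_comm, smul_comm]
    rw [w1, w2, cylLimit, cylLimit, hdn, ← smul_eq_mul (α ^ (k + 1 + (d + 1))),
      ← smul_eq_mul (α ^ (k + 1)), ← dotProduct_smul, ← dotProduct_smul, ← Matrix.smul_mulVec,
      ← Matrix.smul_mulVec, p4, Matrix.smul_mulVec, dotProduct_smul, smul_eq_mul]
    ring

lemma geomCorr_rungLaw (h0 : 0 ≤ α) (h1 : α < 1) :
    GeomCorr (rungLaw (rungWeight α)) ((1 - α) / (1 + α)) α := by
  rcases h0.eq_or_lt with rfl | h0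
  · simpa [rungLaw, rungWeight] using geomCorr_dirac
  · rw [rungLaw, if_neg (by simp [rungWeight, h0.ne']), rungWeight_toReal h0]
    exact geomCorr_rungs h0 h1 (by field_simp)

end rungs

theorem theorem1 :
    (∀ α : ℝ, 0 ≤ α → α < 1 →
      -- the weighted spanning tree measure with weight `c = (1-α)²/(2α) > 0` exists and is unique
      (0 < α → 0 < (rungWeight α).toReal ∧
        (rungWeight α).toReal = (1 - α) ^ 2 / (2 * α) ∧
        IsLadderTreeMeasure (rungWeight α).toReal (ladderTreeMeasure (rungWeight α).toReal) ∧
        ∀ P, IsLadderTreeMeasure (rungWeight α).toReal P →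
          P = ladderTreeMeasure (rungWeight α).toReal) ∧
      -- (i)
      (IsStationaryLaw (rungLaw (rungWeight α)) ∧
        IsHermitianDeterminantal (rungLaw (rungWeight α)) (ladderKernel α) ∧
        IsFourierTransform (ladderSymbol (rungWeight α)) (ladderKernel α) ∧
        IsRenewal (rungLaw (rungWeight α)) ∧
        ∀ m : ℕ, 1 ≤ m →
          (rungLaw (rungWeight α))[{x | IsLeast {k : ℕ | 1 ≤ k ∧ x (k : ℤ) = true} m} |
              {x | x 0 = true}] =
            ENNReal.ofReal ((1 - α) ^ 2 * m * α ^ (m - 1))) ∧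
      -- (ii)
      (∀ p : unitInterval,
        IsStationaryLaw (thinnedLaw p (rungLaw (rungWeight α))) ∧
        IsHermitianDeterminantal (thinnedLaw p (rungLaw (rungWeight α)))
          (((p : ℝ) : ℂ) • ladderKernel α) ∧
        IsFourierTransform (fun x => (p : ℝ) * ladderSymbol (rungWeight α) x)
          (((p : ℝ) : ℂ) • ladderKernel α))) ∧
    -- (iii)
    (∀ ν : Measure (ℤ → Bool), IsProbabilityMeasure ν → IsStationaryLaw ν →
      (∃ A : Matrix ℤ ℤ ℂ, IsHermitianDeterminantal ν A) → IsRenewal ν →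
      ∃ α : ℝ, 0 ≤ α ∧ α < 1 ∧ ∃ p : unitInterval, ν = thinnedLaw p (rungLaw (rungWeight α))) := by
  refine ⟨fun α h0 h1 => ⟨fun h0 => ?_, ?_, fun p => ?_⟩, fun ν _ hs ⟨A, hA⟩ hr => ?_⟩
  · have hc : 2 * α * ((1 - α) ^ 2 / (2 * α)) = (1 - α) ^ 2 := by field_simp
    have hlim := isLadderTreeMeasure_ladderTreeMeasure h0 h1 hc
    rw [rungWeight_toReal h0]
    have : 0 < 1 - α := by linarith
    exact ⟨by positivity, rfl, hlim, fun P hP => hP.unique hlim⟩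
  · have h := geomCorr_rungLaw h0 h1
    have hdet := GeomCorr.isHermitianDeterminantal (p := 1) (by rwa [one_mul])
    have hfourier := isFourierTransform_ladderSymbol h0 h1 1
    simp only [Complex.ofReal_one, one_smul] at hdet
    simp only [Set.Icc.coe_one, Complex.ofReal_one, one_smul, one_mul] at hfourier
    exact ⟨h.isStationaryLaw, hdet, hfourier, h.isRenewal, h.cond_firstReturn h0 h1⟩
  · have h := (geomCorr_rungLaw h0 h1).thinnedLaw p
    exact ⟨h.isStationaryLaw, h.isHermitianDeterminantal,
      isFourierTransform_ladderSymbol h0 h1 p⟩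
  · obtain ⟨α, h0, h1, p, h⟩ := exists_geomCorr hs hA hr
    exact ⟨α, h0, h1, p, h.ext ((geomCorr_rungLaw h0 h1).thinnedLaw p)⟩
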